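/- Let $(\Omega,\mathcal F,P)$ be a non-atomic probability space. Let $L^\infty_{++}$ be the set of random variables $X$ that are $P$-a.s. bounded and $P$-a.s. bounded away from zero (so that $\log X\in L^\infty$), and let $\mathcal Q$ be the set of all probability measures on $(\Omega,\mathcal F)$ that are absolutely continuous with respect to $P$. Write $F_Z^{-1}(\beta)=\inf\{x\in\mathbb R: P[Z\le x]\ge\beta\}$ and, for $\alpha\in[0,1)$ and $X\in L^\infty_{++}$, let $$\mathrm{AR@R}_\alpha(X)=\exp\Big(\int_\alpha^1\frac1{1-\alpha}F^{-1}_{\log X}(\beta)\,\mathrm d\beta\Big)$$ be the Average-Return-at-Risk. Then there is a family $(m_Q)_{Q\in\mathcal Q}$ of probability measures on $[0,1)$ such that the following holds. Let $\tilde\rho\colon L^\infty_{++}\to[0,\infty]$ be - monotone: $X\le Y$ $P$-a.s. implies $\tilde\rho(X)\le\tilde\rho(Y)$; - quasi-logconvex: $\tilde\rho(X^\alpha Y^{1-\alpha})\le\max\{\tilde\rho(X),\tilde\rho(Y)\}$ for all $X,Y\in L^\infty_{++}$ and $\alpha\in(0,1)$; - continuous from below: $X_n\uparrow X$ $P$-a.s.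 with $X_n,X\in L^\infty_{++}$ implies $\tilde\rho(X_n)\to\tilde\rho(X)$; - law invariant: $\tilde\rho(X)=\tilde\rho(Y)$ whenever $X,Y\in L^\infty_{++}$ have the same distribution under $P$. Put $$\mathcal R(t;Q)=\inf\{\tilde\rho(Y): Y\in L^\infty_{++},\ \mathbb E_Q[\log Y]\ge t\},\qquad t\in\mathbb R,\ Q\in\mathcal Q.$$ Then for every $X\in L^\infty_{++}$ the function $\alpha\mapsto\log\mathrm{AR@R}_\alpha(X)$ is $m_Q$-integrable for each $Q\in\mathcal Q$, and $$\tilde\rho(X)=\sup_{Q\in\mathcal Q}\mathcal R\Big(\int_{[0,1)}\log\mathrm{AR@R}_\alpha(X)\,m_Q(\mathrm d\alpha);\,Q\Big).$$ -/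

import Mathlib

open MeasureTheory ProbabilityTheory Filter Topology
open scoped ENNReal

noncomputable section

namespace GeoRisk

variable {Ω : Type*} [MeasurableSpace Ω]

/-- Every measurable set of positive measure has a measurable subset of strictly smaller positive
measure: the measure has no atoms in the measure-theoretic sense. -/
def IsNonatomic (P : Measure Ω) : Prop :=
  ∀ A : Set Ω, MeasurableSet A → 0 < P A →
    ∃ B : Set Ω, B ⊆ A ∧ MeasurableSet B ∧ 0 < P B ∧ P B < P A

/-- `X` belongs to `L^∞_{++}`: it is essentially bounded and essentially bounded away from zero
(equivalently, `X > 0` almost surely, and `X` and `log X` are essentially bounded). -/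
def MemLinfPP (P : Measure Ω) (X : Ω → ℝ) : Prop :=
  MemLp X ∞ P ∧ ∃ c : ℝ, 0 < c ∧ ∀ᵐ ω ∂P, c ≤ X ω

/-! Risk measures are maps `ρ : (Ω → ℝ) → [0,∞]` of which only the values on `L^∞_{++}` matter.
Random variables that agree almost surely get the same value by monotonicity. -/

/-- `X ≤ Y` a.s. implies `ρ X ≤ ρ Y`. -/
def IsMonotone (P : Measure Ω) (ρ : (Ω → ℝ) → ℝ≥0∞) : Prop :=
  ∀ X Y : Ω → ℝ, MemLinfPP P X → MemLinfPP P Y → X ≤ᵐ[P] Y → ρ X ≤ ρ Y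

/-- `ρ (X ^ α * Y ^ (1 - α)) ≤ max (ρ X) (ρ Y)` for `α ∈ (0,1)`. -/
def IsQuasiLogconvex (P : Measure Ω) (ρ : (Ω → ℝ) → ℝ≥0∞) : Prop :=
  ∀ X Y : Ω → ℝ, MemLinfPP P X → MemLinfPP P Y → ∀ α : ℝ, 0 < α → α < 1 →
    ρ (fun ω => X ω ^ α * Y ω ^ (1 - α)) ≤ max (ρ X) (ρ Y)

/-- `X_n ↑ X` a.s. implies `ρ X_n → ρ X`. -/
def IsContinuousFromBelow (P : Measure Ω) (ρ : (Ω → ℝ) → ℝ≥0∞) : Prop :=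
  ∀ (X : ℕ → Ω → ℝ) (Y : Ω → ℝ), (∀ n, MemLinfPP P (X n)) → MemLinfPP P Y →
    (∀ n, X n ≤ᵐ[P] X (n + 1)) → (∀ᵐ ω ∂P, Tendsto (fun n => X n ω) atTop (𝓝 (Y ω))) →
    Tendsto (fun n => ρ (X n)) atTop (𝓝 (ρ Y))

/-- `ρ X = ρ Y` whenever `X` and `Y` have the same distribution under `P`. -/
def IsLawInvariant (P : Measure Ω) (ρ : (Ω → ℝ) → ℝ≥0∞) : Prop :=
  ∀ X Y : Ω → ℝ, MemLinfPP P X → MemLinfPP P Y → IdentDistrib X Y P P → ρ X = ρ Y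

/-- The probability measures that are absolutely continuous with respect to `P`. -/
abbrev AbsContProb (P : Measure Ω) : Type _ :=
  {Q : ProbabilityMeasure Ω // (Q : Measure Ω) ≪ P}

/-- The smallest `β`-quantile `F_Z⁻¹(β) = inf {x | β ≤ P[Z ≤ x]}`. -/
def quantile (P : Measure Ω) (Z : Ω → ℝ) (β : ℝ) : ℝ :=
  sInf {x : ℝ | β ≤ P.real {ω | Z ω ≤ x}}

/-- Average-Value-at-Risk `(1 - α)⁻¹ ∫_α^1 F_Z⁻¹(β) dβ`, for `α ∈ [0,1)`. -/
def avar (P : Measure Ω) (α : ℝ) (Z : Ω → ℝ) : ℝ :=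
  ∫ β in α..1, (1 / (1 - α)) * quantile P Z β

/-- Average-Return-at-Risk `exp (AV@R_α (log X))`, for `α ∈ [0,1)`. -/
def arar (P : Measure Ω) (α : ℝ) (X : Ω → ℝ) : ℝ :=
  Real.exp (avar P α (fun ω => Real.log (X ω)))

/-- `𝓡(t; Q) = inf {ρ Y | Y ∈ L^∞_{++}, E_Q[log Y] ≥ t}`. -/
def dualR (P : Measure Ω) (ρ : (Ω → ℝ) → ℝ≥0∞) (t : ℝ) (Q : AbsContProb P) : ℝ≥0∞ :=
  sInf (ρ '' {Y : Ω → ℝ | MemLinfPP P Y ∧ t ≤ ∫ ω, Real.log (Y ω) ∂(Q.1 : Measure Ω)})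

end GeoRisk

end

namespace GeoRisk

/-! ### Nonatomic measures take all intermediate values -/

section Nonatomic

variable {Ω : Type*} [MeasurableSpace Ω] {P : Measure Ω} [IsProbabilityMeasure P]

/-! On the log scale, `ψ W = ρ (exp W)` is monotone, quasi-convex, law invariant and continuous from
below on `L^∞`, and `log AR@R_α X` is the `AV@R_α` of `Z = log X`. For `Q` with density `D`, let `U`
be uniform and comonotone with `D`, and write `q_Z` for the quantile function of `Z`. Splitting `D`
into layers `{D > s}`, which are the events `{U > F_D(s)}` up to null sets, gives `E_P[D q_Z(U)] = ∫
AV@R_α(Z) m_Q(dα)`, where `m_Q` depends on the law of `D` alone. By Hardy–Littlewood this is the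
largest value of `E_Q[Z']` over all `Z'` distributed like `Z`.

One inequality is then immediate: `q_Z(U)` has the law of `Z`, hence the same risk, and meets the
constraint in `𝓡` with equality (`IsNonatomic.exists_identDistrib_integral_eq`).

For the other, each `c < ψ Z` needs a `Q` for which every `Y` satisfying the constraint has `ψ Y >
c` (`IsLawInvariantRisk.exists_dual_certificate`). No duality in infinite dimensions is used.
Continuity from below replaces `q_Z` by a step function `z` on a grid of `n` equal cells. Step
functions of risk at most `c` form a convex, permutation-invariant set in `ℝ^n`; Hahn–Banach
separates it from `z` by a probability vector, which the rearrangement inequality allows to be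
sorted, and this vector defines the density of `Q`. An arbitrary `Y` is brought to the grid by
averaging its quantile function over cells. That does not raise the risk, because a cell mean is
nearly an average of permuted step functions on a finer grid
(`IsLawInvariantRisk.cellMean_extQuantile_le`). -/

theorem IsNonatomic.exists_subset_le_half (hP : IsNonatomic P) {A : Set Ω}
    (hA : MeasurableSet A) (h0 : 0 < P.real A) :
    ∃ B ⊆ A, MeasurableSet B ∧ 0 < P.real B ∧ P.real B ≤ P.real A / 2 := by
  obtain ⟨B, hBA, hB, hB0, hlt⟩ := hP A hA (by
    rw [pos_iff_ne_zero]; intro h; simp [Measure.real, h] at h0)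
  have h1 : 0 < P.real B := ENNReal.toReal_pos hB0.ne' (measure_ne_top _ _)
  have h2 : P.real B < P.real A :=
    (ENNReal.toReal_lt_toReal (measure_ne_top _ _) (measure_ne_top _ _)).2 hlt
  have h3 : P.real (A \ B) = P.real A - P.real B := measureReal_sdiff hBA hB
  rcases le_total (P.real B) (P.real A / 2) with h | h
  · exact ⟨B, hBA, hB, h1, h⟩
  · exact ⟨A \ B, Set.sdiff_subset, hA.diff hB, by linarith, by linarith⟩

theorem IsNonatomic.exists_subset_lt (hP : IsNonatomic P) {A : Set Ω}
    (hA : MeasurableSet A) (h0 : 0 < P.real A) {ε : ℝ} (hε : 0 < ε) :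
    ∃ B ⊆ A, MeasurableSet B ∧ 0 < P.real B ∧ P.real B < ε := by
  have key : ∀ n : ℕ, ∃ B ⊆ A, MeasurableSet B ∧ 0 < P.real B ∧ P.real B ≤ (1 / 2) ^ n := by
    intro n
    induction n with
    | zero => exact ⟨A, subset_rfl, hA, h0, by simp⟩
    | succ n ih =>
      obtain ⟨B, hBA, hB, hB0, hBn⟩ := ih
      obtain ⟨C, hCB, hC, hC0, hCn⟩ := hP.exists_subset_le_half hB hB0
      exact ⟨C, hCB.trans hBA, hC, hC0, by rw [pow_succ]; linarith⟩
  obtain ⟨n, hn⟩ := exists_pow_lt_of_lt_one hε (show (1 / 2 : ℝ) < 1 by norm_num)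
  obtain ⟨B, hBA, hB, hB0, hBn⟩ := key n
  exact ⟨B, hBA, hB, hB0, hBn.trans_lt hn⟩

/-- Greedy exhaustion: each step gains at least half of what any admissible enlargement could gain.
If the union stayed below mass `t`, a small leftover set could be added at every stage, so the gains
would not tend to zero although the masses converge. -/
theorem IsNonatomic.exists_subset_eq (hP : IsNonatomic P) {A : Set Ω}
    (hA : MeasurableSet A) {t : ℝ} (ht0 : 0 ≤ t) (htA : t ≤ P.real A) :
    ∃ B ⊆ A, MeasurableSet B ∧ P.real B = t := by
  let S : Type _ := {B : Set Ω // B ⊆ A ∧ MeasurableSet B ∧ P.real B ≤ t}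
  have step : ∀ B : S, ∃ B' : S, B.1 ⊆ B'.1 ∧ ∀ C : S, B.1 ⊆ C.1 →
      P.real C.1 - P.real B.1 ≤ 2 * (P.real B'.1 - P.real B.1) := by
    intro B
    let V : Set ℝ := {x | ∃ C : S, B.1 ⊆ C.1 ∧ x = P.real C.1 - P.real B.1}
    have hV0 : (0 : ℝ) ∈ V := ⟨B, subset_rfl, by simp⟩
    have hVb : BddAbove V := ⟨1, by
      rintro x ⟨C, -, rfl⟩
      have h1 : P.real C.1 ≤ 1 := measureReal_le_one
      have h2 : 0 ≤ P.real B.1 := measureReal_nonneg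
      linarith⟩
    have hs0 : 0 ≤ sSup V := le_csSup hVb hV0
    rcases hs0.eq_or_lt with hs | hs
    · refine ⟨B, subset_rfl, fun C hC => ?_⟩
      have : P.real C.1 - P.real B.1 ≤ sSup V := le_csSup hVb ⟨C, hC, rfl⟩
      linarith
    · obtain ⟨x, ⟨B', hB', rfl⟩, hx⟩ := exists_lt_of_lt_csSup ⟨0, hV0⟩ (half_lt_self hs)
      refine ⟨B', hB', fun C hC => ?_⟩
      have : P.real C.1 - P.real B.1 ≤ sSup V := le_csSup hVb ⟨C, hC, rfl⟩
      linarith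
  choose next hnext hmax using step
  let b : ℕ → S := fun n => next^[n] ⟨∅, Set.empty_subset _, MeasurableSet.empty, by simpa using ht0⟩
  have hb : ∀ n, b (n + 1) = next (b n) := fun n => Function.iterate_succ_apply' _ _ _
  have hmono : Monotone fun n => (b n).1 := monotone_nat_of_le_succ fun n => by
    rw [hb]; exact hnext _
  have hlim : Tendsto (fun n => P.real (b n).1) atTop (𝓝 (P.real (⋃ n, (b n).1))) :=
    (ENNReal.tendsto_toReal (measure_ne_top _ _)).comp (tendsto_measure_iUnion_atTop hmono)
  have hU : (⋃ n, (b n).1) ⊆ A := Set.iUnion_subset fun n => (b n).2.1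
  have hUm : MeasurableSet (⋃ n, (b n).1) := MeasurableSet.iUnion fun n => (b n).2.2.1
  have hUt : P.real (⋃ n, (b n).1) ≤ t := le_of_tendsto' hlim fun n => (b n).2.2.2
  refine ⟨_, hU, hUm, hUt.antisymm (not_lt.1 fun hlt => ?_)⟩
  have hdiff : P.real (A \ ⋃ n, (b n).1) = P.real A - P.real (⋃ n, (b n).1) :=
    measureReal_sdiff hU hUm
  obtain ⟨C, hC, hCm, hC0, hCt⟩ := hP.exists_subset_lt (hA.diff hUm) (by rw [hdiff]; linarith)
    (sub_pos.2 hlt)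
  have hdisj : Disjoint (⋃ n, (b n).1) C := (Set.disjoint_sdiff_right).mono_right hC
  have hunion : P.real ((⋃ n, (b n).1) ∪ C) = P.real (⋃ n, (b n).1) + P.real C :=
    measureReal_union hdisj hCm
  let E : S := ⟨(⋃ n, (b n).1) ∪ C, Set.union_subset hU (hC.trans Set.sdiff_subset), hUm.union hCm,
    by rw [hunion]; linarith⟩
  have hlow : ∀ n, P.real C ≤ 2 * (P.real (b (n + 1)).1 - P.real (b n).1) := by
    intro n
    have h1 := hmax (b n) E ((Set.subset_iUnion (fun n => (b n).1) n).trans Set.subset_union_left)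
    rw [← hb] at h1
    have h2 : P.real (b n).1 ≤ P.real (⋃ n, (b n).1) :=
      measureReal_mono (Set.subset_iUnion (fun n => (b n).1) n)
    have h3 : P.real E.1 = P.real (⋃ n, (b n).1) + P.real C := hunion
    linarith
  have hz : Tendsto (fun n => 2 * (P.real (b (n + 1)).1 - P.real (b n).1)) atTop (𝓝 0) := by
    simpa using ((hlim.comp (tendsto_add_atTop_nat 1)).sub hlim).const_mul 2
  exact absurd (ge_of_tendsto' hz hlow) (not_le.2 hC0)

/-! ### A uniform random variable comonotone with a given one -/

/-- Sets whose points have values of `D` at most those of the points outside. -/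
def IsSublevelLike (D : Ω → ℝ) (B : Set Ω) : Prop :=
  MeasurableSet B ∧ ∀ ω ∈ B, ∀ ω' ∉ B, D ω ≤ D ω'

/-- With `d` a median of `D` on `B' \ B`, the part `{D < d}` carries at most half of the mass and
`{D ≤ d}` at least half. Nonatomicity lets a piece of the level set `{D = d}` make up the
difference. -/
theorem IsNonatomic.exists_sublevelLike_between (hP : IsNonatomic P) {D : Ω → ℝ}
    (hD : Measurable D) {B B' : Set Ω} (hB : IsSublevelLike D B) (hB' : IsSublevelLike D B')
    (hBB' : B ⊆ B') :
    ∃ C, IsSublevelLike D C ∧ B ⊆ C ∧ C ⊆ B' ∧ P.real C = (P.real B + P.real B') / 2 := by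
  have hAm : MeasurableSet (B' \ B) := hB'.1.diff hB.1
  have hAr : P.real (B' \ B) = P.real B' - P.real B := measureReal_sdiff hBB' hB.1
  have hAn : 0 ≤ P.real (B' \ B) := measureReal_nonneg
  rcases hAn.eq_or_lt with h0 | h0
  · exact ⟨B, hB, subset_rfl, hBB', by linarith⟩
  set A := B' \ B with hA
  set t := P.real A / 2 with ht
  have hle : ∀ x, MeasurableSet (A ∩ {ω | D ω ≤ x}) := fun x =>
    hAm.inter (measurableSet_le hD measurable_const)
  have hltm : ∀ x, MeasurableSet (A ∩ {ω | D ω < x}) := fun x =>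
    hAm.inter (measurableSet_lt hD measurable_const)
  have htop : Tendsto (fun n : ℕ => P.real (A ∩ {ω | D ω ≤ n})) atTop (𝓝 (P.real A)) := by
    have hm : Monotone fun n : ℕ => A ∩ {ω | D ω ≤ n} := fun m n hmn =>
      Set.inter_subset_inter_right _ fun ω (hω : D ω ≤ m) => hω.trans (by exact_mod_cast hmn)
    have := (ENNReal.tendsto_toReal (measure_ne_top _ _)).comp
      (tendsto_measure_iUnion_atTop (μ := P) hm)
    rwa [show (⋃ n : ℕ, A ∩ {ω | D ω ≤ n}) = A by
      ext ω
      simp only [Set.mem_iUnion, Set.mem_inter_iff, Set.mem_ofPred_eq, exists_and_left,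
        and_iff_left_iff_imp]
      exact fun _ => exists_nat_ge _] at this
  have hbot : Tendsto (fun n : ℕ => P.real (A ∩ {ω | D ω ≤ -n})) atTop (𝓝 0) := by
    have hm : Antitone fun n : ℕ => A ∩ {ω | D ω ≤ -n} := fun m n hmn =>
      Set.inter_subset_inter_right _ fun ω (hω : D ω ≤ -n) => hω.trans
        (by simpa using hmn)
    have := (ENNReal.tendsto_toReal (measure_ne_top _ _)).comp
      (tendsto_measure_iInter_atTop (μ := P) (fun n => (hle _).nullMeasurableSet) hm
        ⟨0, measure_ne_top _ _⟩)
    rw [show (⋂ n : ℕ, A ∩ {ω | D ω ≤ -n}) = ∅ by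
      ext ω
      simp only [Set.mem_iInter, Set.mem_inter_iff, Set.mem_ofPred_eq, Set.mem_empty_iff_false,
        iff_false, not_forall]
      obtain ⟨n, hn⟩ := exists_nat_gt (-D ω)
      exact ⟨n, fun h => by linarith [h.2]⟩, measure_empty] at this
    exact this
  let V : Set ℝ := {x | t ≤ P.real (A ∩ {ω | D ω ≤ x})}
  have hVne : V.Nonempty := by
    obtain ⟨n, hn⟩ := (htop.eventually (lt_mem_nhds (show t < P.real A by linarith))).exists
    exact ⟨n, hn.le⟩
  have hVb : BddBelow V := by
    obtain ⟨n, hn⟩ := (hbot.eventually (gt_mem_nhds (show 0 < t by linarith))).exists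
    refine ⟨-n, fun x hx => not_lt.1 fun hlt => ?_⟩
    have : P.real (A ∩ {ω | D ω ≤ x}) ≤ P.real (A ∩ {ω | D ω ≤ -n}) :=
      measureReal_mono (Set.inter_subset_inter_right _ fun ω (hω : D ω ≤ x) => hω.trans hlt.le)
    have hx' : t ≤ P.real (A ∩ {ω | D ω ≤ x}) := hx
    linarith
  set d := sInf V with hd
  have hlow : P.real (A ∩ {ω | D ω < d}) ≤ t := by
    have hm : Monotone fun n : ℕ => A ∩ {ω | D ω ≤ d - 1 / (n + 1 : ℝ)} := fun m n hmn =>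
      Set.inter_subset_inter_right _ fun ω (hω : D ω ≤ d - 1 / (m + 1 : ℝ)) => hω.trans
        (sub_le_sub_left (one_div_le_one_div_of_le (by positivity) (by
          exact_mod_cast Nat.succ_le_succ hmn)) _)
    have hl := (ENNReal.tendsto_toReal (measure_ne_top _ _)).comp
      (tendsto_measure_iUnion_atTop (μ := P) hm)
    rw [show (⋃ n : ℕ, A ∩ {ω | D ω ≤ d - 1 / (n + 1 : ℝ)}) = A ∩ {ω | D ω < d} by
      ext ω
      simp only [Set.mem_iUnion, Set.mem_inter_iff, Set.mem_ofPred_eq, exists_and_left,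
        and_congr_right_iff]
      refine fun _ => ⟨fun ⟨n, hn⟩ => hn.trans_lt (sub_lt_self _ (by positivity)), fun h => ?_⟩
      obtain ⟨n, hn⟩ := exists_nat_one_div_lt (sub_pos.2 h)
      exact ⟨n, by linarith⟩] at hl
    refine le_of_tendsto' hl fun n => not_lt.1 fun hlt => ?_
    have : d ≤ d - 1 / (n + 1 : ℝ) := csInf_le hVb hlt.le
    have : (0 : ℝ) < 1 / (n + 1 : ℝ) := by positivity
    linarith
  have hhigh : t ≤ P.real (A ∩ {ω | D ω ≤ d}) := by
    have hm : Antitone fun n : ℕ => A ∩ {ω | D ω ≤ d + 1 / (n + 1 : ℝ)} := fun m n hmn =>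
      Set.inter_subset_inter_right _ fun ω (hω : D ω ≤ d + 1 / (n + 1 : ℝ)) => hω.trans
        (add_le_add_right (one_div_le_one_div_of_le (by positivity) (by
          exact_mod_cast Nat.succ_le_succ hmn)) _)
    have hl := (ENNReal.tendsto_toReal (measure_ne_top _ _)).comp
      (tendsto_measure_iInter_atTop (μ := P) (fun n => (hle _).nullMeasurableSet) hm
        ⟨0, measure_ne_top _ _⟩)
    rw [show (⋂ n : ℕ, A ∩ {ω | D ω ≤ d + 1 / (n + 1 : ℝ)}) = A ∩ {ω | D ω ≤ d} by
      ext ω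
      simp only [Set.mem_iInter, Set.mem_inter_iff, Set.mem_ofPred_eq]
      refine ⟨fun h => ⟨(h 0).1, le_of_forall_pos_le_add fun ε hε => ?_⟩, fun h n => ⟨h.1, h.2.trans
        (le_add_of_nonneg_right (by positivity))⟩⟩
      obtain ⟨n, hn⟩ := exists_nat_one_div_lt hε
      linarith [(h n).2]] at hl
    refine ge_of_tendsto' hl fun n => ?_
    obtain ⟨x, hx, hxd⟩ := exists_lt_of_csInf_lt hVne
      (show sInf V < d + 1 / (n + 1 : ℝ) from lt_add_of_pos_right _ (by positivity))
    exact (show t ≤ P.real (A ∩ {ω | D ω ≤ x}) from hx).trans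
      (measureReal_mono (Set.inter_subset_inter_right _ fun ω (hω : D ω ≤ x) => hω.trans hxd.le))
  have heqm : MeasurableSet (A ∩ {ω | D ω = d}) :=
    hAm.inter (measurableSet_eq_fun hD measurable_const)
  have hdisj : Disjoint (A ∩ {ω | D ω < d}) (A ∩ {ω | D ω = d}) :=
    Set.disjoint_left.2 fun ω h1 h2 => (h1.2 : D ω < d).ne h2.2
  have hsplit : P.real (A ∩ {ω | D ω ≤ d}) =
      P.real (A ∩ {ω | D ω < d}) + P.real (A ∩ {ω | D ω = d}) := by
    rw [← measureReal_union hdisj heqm, ← Set.inter_union_distrib_left]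
    congr 2
    ext ω
    exact le_iff_lt_or_eq (a := D ω)
  obtain ⟨C, hC, hCm, hCr⟩ := hP.exists_subset_eq heqm (t := t - P.real (A ∩ {ω | D ω < d}))
    (by linarith) (by linarith)
  have hsub1 : A ∩ {ω | D ω < d} ⊆ B' := fun ω h => h.1.1
  have hsub2 : C ⊆ B' := fun ω h => (hC h).1.1
  have hd1 : Disjoint (A ∩ {ω | D ω < d}) C := hdisj.mono_right hC
  have hd2 : Disjoint B (A ∩ {ω | D ω < d} ∪ C) := by
    refine Set.disjoint_left.2 fun ω h1 h2 => ?_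
    rcases h2 with h2 | h2
    · exact h2.1.2 h1
    · exact (hC h2).1.2 h1
  refine ⟨B ∪ (A ∩ {ω | D ω < d} ∪ C), ⟨hB.1.union ((hltm d).union hCm), ?_⟩,
    Set.subset_union_left, Set.union_subset hBB' (Set.union_subset hsub1 hsub2), ?_⟩
  · intro ω hω ω' hω'
    have hω'B : ω' ∉ B := fun h => hω' (Or.inl h)
    rcases hω with hω | hω
    · exact hB.2 ω hω ω' hω'B
    · have hωd : D ω ≤ d := by
        rcases hω with h | h
        · exact (show D ω < d from h.2).le
        · exact (show D ω = d from (hC h).2).le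
      have hωB' : ω ∈ B' := by
        rcases hω with h | h
        exacts [hsub1 h, hsub2 h]
      by_cases h' : ω' ∈ B'
      · exact hωd.trans (not_lt.1 fun hlt => hω' (Or.inr (Or.inl ⟨⟨h', hω'B⟩, hlt⟩)))
      · exact hB'.2 ω hωB' ω' h'
  · rw [measureReal_union hd2 ((hltm d).union hCm), measureReal_union hd1 hCm, hCr]
    linarith

/-- `U` is uniformly distributed on the unit interval under `P`. -/
def IsUniform (P : Measure Ω) (U : Ω → ℝ) : Prop :=
  Measurable U ∧ P.map U = volume.restrict (Set.Ioo (0 : ℝ) 1)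

end Nonatomic
-- Dyadic construction of the comonotone uniform variable
section Comonotone

variable {Ω : Type*} [MeasurableSpace Ω] {P : Measure Ω} [IsProbabilityMeasure P]

/-- A dyadic increasing family of sublevel-like sets exhausting all dyadic masses. -/
theorem IsNonatomic.exists_dyadic_family (hP : IsNonatomic P) {D : Ω → ℝ} (hD : Measurable D) :
    ∃ f : ℕ → ℕ → Set Ω, (∀ m n, IsSublevelLike D (f m n)) ∧ (∀ m, Monotone (f m)) ∧
      (∀ m n, f (m + 1) (2 * n) = f m n) ∧
      ∀ m n, P.real (f m n) = min (n / 2 ^ m : ℝ) 1 := by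
  let T : Type _ := {B : Set Ω // IsSublevelLike D B}
  have step : ∀ B B' : T, ∃ C : T, B.1 ⊆ B'.1 →
      (B.1 ⊆ C.1 ∧ C.1 ⊆ B'.1 ∧ P.real C.1 = (P.real B.1 + P.real B'.1) / 2) := by
    intro B B'
    by_cases h : B.1 ⊆ B'.1
    · obtain ⟨C, hC, h1, h2, h3⟩ := hP.exists_sublevelLike_between hD B.2 B'.2 h
      exact ⟨⟨C, hC⟩, fun _ => ⟨h1, h2, h3⟩⟩
    · exact ⟨B, fun h' => absurd h' h⟩
  choose mid hmid using step
  -- Every index from 1 on gives the whole space, so that after `m` refinements the family saturates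
  -- at mass 1 from index `2 ^ m` on.
  let f₀ : ℕ → T := fun n => if n = 0 then ⟨∅, MeasurableSet.empty, by simp⟩
    else ⟨Set.univ, MeasurableSet.univ, by simp⟩
  let next : (ℕ → T) → ℕ → T := fun g n =>
    if n % 2 = 0 then g (n / 2) else mid (g (n / 2)) (g (n / 2 + 1))
  let f : ℕ → ℕ → T := fun m => next^[m] f₀
  have hf : ∀ m, f (m + 1) = next (f m) := fun m => Function.iterate_succ_apply' _ _ _
  have heven : ∀ m n, f (m + 1) (2 * n) = f m n := fun m n => by
    rw [hf]; simp [next]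
  have hodd : ∀ m n, f (m + 1) (2 * n + 1) = mid (f m n) (f m (n + 1)) := fun m n => by
    rw [hf]
    have h1 : (2 * n + 1) % 2 ≠ 0 := by omega
    have h2 : (2 * n + 1) / 2 = n := by omega
    simp only [next, if_neg h1, h2]
  have hmono : ∀ m n, (f m n).1 ⊆ (f m (n + 1)).1 := by
    intro m
    induction m with
    | zero =>
      intro n
      rcases n with _ | n
      · simp [f, f₀]
      · simp [f, f₀]
    | succ m ih =>
      intro n
      rcases Nat.even_or_odd' n with ⟨k, rfl | rfl⟩
      · rw [heven, hodd]; exact (hmid _ _ (ih k)).1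
      · rw [hodd, show 2 * k + 1 + 1 = 2 * (k + 1) by ring, heven]
        exact (hmid _ _ (ih k)).2.1
  refine ⟨fun m n => (f m n).1, fun m n => (f m n).2, fun m => monotone_nat_of_le_succ (hmono m),
    fun m n => congrArg _ (heven m n), ?_⟩
  intro m
  induction m with
  | zero =>
    intro n
    rcases n with _ | n
    · simp [f, f₀]
    · simp [f, f₀]
  | succ m ih =>
    intro n
    have h2 : (0 : ℝ) < 2 ^ m := by positivity
    rcases Nat.even_or_odd' n with ⟨k, rfl | rfl⟩
    · simp only [heven]
      rw [ih]
      congr 1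
      push_cast
      rw [pow_succ]
      field_simp
    · simp only [hodd]
      rw [(hmid _ _ (hmono m k)).2.2, ih, ih]
      push_cast
      rcases lt_or_ge k (2 ^ m) with h | h
      · have h' : (k + 1 : ℝ) ≤ 2 ^ m := by exact_mod_cast h
        rw [min_eq_left, min_eq_left, min_eq_left]
        · rw [pow_succ]; field_simp; ring
        · rw [pow_succ, div_le_one (by positivity)]; linarith
        · rw [div_le_one h2]; exact h'
        · rw [div_le_one h2]; linarith
      · have h' : (2 : ℝ) ^ m ≤ k := by exact_mod_cast h
        rw [min_eq_right, min_eq_right, min_eq_right]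
        · norm_num
        · rw [pow_succ, le_div_iff₀ (by positivity)]; linarith
        · rw [le_div_iff₀ h2]; linarith
        · rw [le_div_iff₀ h2]; linarith

theorem exists_dyadic_between {x y : ℝ} (hx : 0 ≤ x) (hxy : x < y) :
    ∃ m n : ℕ, x < n / 2 ^ m ∧ (n / 2 ^ m : ℝ) < y := by
  obtain ⟨m, hm⟩ := exists_pow_lt_of_lt_one (sub_pos.2 hxy) (show (1 / 2 : ℝ) < 1 by norm_num)
  have h2 : (0 : ℝ) < 2 ^ m := by positivity
  refine ⟨m, ⌊x * 2 ^ m⌋₊ + 1, ?_, ?_⟩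
  · rw [lt_div_iff₀ h2]; push_cast; exact Nat.lt_floor_add_one _
  · rw [div_lt_iff₀ h2]
    have h1 := Nat.floor_le (show 0 ≤ x * 2 ^ m by positivity)
    rw [one_div, inv_pow, inv_lt_iff_one_lt_mul₀ h2] at hm
    push_cast
    nlinarith

theorem volume_restrict_Ioo_zero_one_Iic (x : ℝ) :
    volume.restrict (Set.Ioo (0 : ℝ) 1) (Set.Iic x) = ENNReal.ofReal (max 0 (min x 1)) := by
  rw [Measure.restrict_apply measurableSet_Iic]
  rcases le_or_gt 1 x with hx | hx
  · rw [min_eq_right hx, Set.inter_eq_right.2 fun y hy => hy.2.le.trans hx]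
    simp
  · rw [min_eq_left hx.le, show Set.Iic x ∩ Set.Ioo 0 1 = Set.Ioc 0 x by
      ext y
      exact ⟨fun h => ⟨h.2.1, h.1⟩, fun h => ⟨h.2, h.1, h.2.trans_lt hx⟩⟩]
    simp

theorem isUniform_of_measureReal_lt {U : Ω → ℝ} (hU : Measurable U)
    (h : ∀ x ∈ Set.Ioo (0 : ℝ) 1, P.real {ω | U ω < x} = x) : IsUniform P U := by
  refine ⟨hU, ?_⟩
  have : IsProbabilityMeasure (P.map U) := Measure.isProbabilityMeasure_map hU.aemeasurable
  refine Measure.ext_of_Iic _ _ fun x => ?_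
  rw [Measure.map_apply hU measurableSet_Iic, volume_restrict_Ioo_zero_one_Iic,
    ← ofReal_measureReal]
  congr 1
  change P.real {ω | U ω ≤ x} = _
  apply le_antisymm
  · rcases le_or_gt 1 x with hx | hx
    · rw [min_eq_right hx]; simp
    · rw [min_eq_left hx.le]
      refine le_of_forall_gt_imp_ge_of_dense fun y hy => ?_
      rcases le_or_gt 1 y with hy1 | hy1
      · exact measureReal_le_one.trans hy1
      · have hy0 : 0 < y := (le_max_left 0 x).trans_lt hy
        rw [← h y ⟨hy0, hy1⟩]
        exact measureReal_mono fun ω (hω : U ω ≤ x) => hω.trans_lt ((le_max_right 0 x).trans_lt hy)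
  · refine max_le measureReal_nonneg (le_of_forall_lt_imp_le_of_dense fun y hy => ?_)
    rcases le_or_gt y 0 with hy0 | hy0
    · exact hy0.trans measureReal_nonneg
    · rw [← h y ⟨hy0, hy.trans_le (min_le_right _ _)⟩]
      exact measureReal_mono fun ω (hω : U ω < y) => hω.le.trans (hy.le.trans (min_le_left _ _))

omit [IsProbabilityMeasure P] in
theorem IsUniform.measureReal_le {U : Ω → ℝ} (hU : IsUniform P U) (x : ℝ) :
    P.real {ω | U ω ≤ x} = max 0 (min x 1) := by
  have h : P {ω | U ω ≤ x} = ENNReal.ofReal (max 0 (min x 1)) := by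
    rw [← volume_restrict_Ioo_zero_one_Iic, ← hU.2, Measure.map_apply hU.1 measurableSet_Iic]
    rfl
  rw [Measure.real, h, ENNReal.toReal_ofReal (le_max_left _ _)]

omit [IsProbabilityMeasure P] in
theorem IsUniform.measureReal_lt {U : Ω → ℝ} (hU : IsUniform P U) (x : ℝ) :
    P.real {ω | U ω < x} = max 0 (min x 1) := by
  rw [← hU.measureReal_le]
  refine measureReal_congr ?_
  have h : ∀ᵐ u ∂(P.map U), u ≠ x := by
    rw [hU.2]
    exact Measure.ae_ne _ _
  filter_upwards [ae_of_ae_map hU.1.aemeasurable h] with ω hω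
  exact propext ⟨fun h' => le_of_lt h', fun h' => lt_of_le_of_ne h' hω⟩

omit [IsProbabilityMeasure P] in
theorem IsUniform.ae_mem {U : Ω → ℝ} (hU : IsUniform P U) :
    ∀ᵐ ω ∂P, U ω ∈ Set.Ioo (0 : ℝ) 1 := by
  have h : ∀ᵐ u ∂(P.map U), u ∈ Set.Ioo (0 : ℝ) 1 := by
    rw [hU.2]
    exact ae_restrict_mem measurableSet_Ioo
  exact ae_of_ae_map hU.1.aemeasurable h

/-- The sublevel sets of `D` are, up to null sets, sublevel sets of `U` with the same mass. -/
def IsComonotone (P : Measure Ω) (D U : Ω → ℝ) : Prop :=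
  ∀ s : ℝ, {ω | D ω ≤ s} =ᵐ[P] {ω | U ω ≤ P.real {ω | D ω ≤ s}}

/-- Uniformity turns the value `U ω` into the mass of `{U < U ω}` and of `{U ≤ U ω}`. If `D ω ≤ s`,
the first set lies in `{D ≤ s}`; otherwise the second contains `{D ≤ s}`. The tie `U ω = P[D ≤ s]`
is a null event. -/
theorem IsUniform.isComonotone {D U : Ω → ℝ} (hU : IsUniform P U)
    (h : ∀ ω ω', U ω < U ω' → D ω ≤ D ω') : IsComonotone P D U := by
  intro s
  set p := P.real {ω | D ω ≤ s} with hp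
  have hne : ∀ᵐ ω ∂P, U ω ≠ p := by
    have h : ∀ᵐ u ∂(P.map U), u ≠ p := by
      rw [hU.2]
      exact Measure.ae_ne _ _
    exact ae_of_ae_map hU.1.aemeasurable h
  filter_upwards [hU.ae_mem, hne] with ω hω hωp
  refine propext ⟨fun h' => not_lt.1 fun hlt => ?_, fun h' => not_lt.1 fun hlt => ?_⟩
  · have h1 : U ω ≤ p := by
      calc U ω = P.real {ω' | U ω' < U ω} := by
            rw [hU.measureReal_lt, min_eq_left hω.2.le, max_eq_right hω.1.le]
        _ ≤ p := measureReal_mono fun ω' (hω' : U ω' < U ω) => (h _ _ hω').trans h'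
    exact absurd hlt (not_lt.2 h1)
  · have h1 : p ≤ U ω := by
      calc p ≤ P.real {ω' | U ω' ≤ U ω} :=
            measureReal_mono fun ω' (hω' : D ω' ≤ s) =>
              not_lt.1 fun h'' => absurd ((h _ _ h'').trans hω') (not_le.2 hlt)
        _ = U ω := by rw [hU.measureReal_le, min_eq_left hω.2.le, max_eq_right hω.1.le]
    exact hωp (le_antisymm h' h1)

omit [IsProbabilityMeasure P] in
theorem IsComonotone.congr {D D' U : Ω → ℝ} (h : IsComonotone P D U) (hD : D =ᵐ[P] D') :
    IsComonotone P D' U := by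
  intro s
  have h1 : {ω | D' ω ≤ s} =ᵐ[P] {ω | D ω ≤ s} := by
    filter_upwards [hD] with ω hω
    exact propext (by change D' ω ≤ s ↔ D ω ≤ s; rw [hω])
  rw [measureReal_congr h1]
  exact h1.trans (h s)

/-- On a nonatomic space every random variable is comonotone with a uniform one. -/
theorem IsNonatomic.exists_comonotone_uniform (hP : IsNonatomic P) {D : Ω → ℝ}
    (hD : Measurable D) :
    ∃ U : Ω → ℝ, IsUniform P U ∧ ∀ ω ω', U ω < U ω' → D ω ≤ D ω' := by
  obtain ⟨f, hf, hmono, heven, hmeas⟩ := hP.exists_dyadic_family hD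
  have hrefine : ∀ k m n, f (m + k) (2 ^ k * n) = f m n := by
    intro k
    induction k with
    | zero => simp
    | succ k ih => intro m n; rw [pow_succ', mul_assoc, ← add_assoc, heven, ih]
  have hnest : ∀ m n m' n' : ℕ, (n / 2 ^ m : ℝ) ≤ n' / 2 ^ m' → f m n ⊆ f m' n' := by
    intro m n m' n' h
    rw [← hrefine m' m n, ← hrefine m m' n', add_comm m' m]
    apply hmono
    rw [div_le_div_iff₀ (by positivity) (by positivity)] at h
    have : n * 2 ^ m' ≤ n' * 2 ^ m := by exact_mod_cast h
    linarith
  -- `U ω` is the infimum of the dyadic masses whose set already contains `ω`. The extra element 1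
  -- bounds `U` above by 1 and rules out the infimum of an empty set.
  let V : Ω → Set ℝ := fun ω => {x | x = 1 ∨ ∃ m n : ℕ, x = n / 2 ^ m ∧ ω ∈ f m n}
  have hVb : ∀ ω, BddBelow (V ω) := fun ω => ⟨0, by
    rintro x (rfl | ⟨m, n, rfl, -⟩)
    · exact zero_le_one
    · positivity⟩
  have hVne : ∀ ω, (V ω).Nonempty := fun ω => ⟨1, Or.inl rfl⟩
  let U : Ω → ℝ := fun ω => sInf (V ω)
  have hlt : ∀ x ≤ 1, {ω | U ω < x} = ⋃ m : ℕ, ⋃ n : ℕ, ⋃ _ : (n / 2 ^ m : ℝ) < x, f m n := by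
    intro x hx
    ext ω
    simp only [Set.mem_iUnion]
    constructor
    · intro h
      obtain ⟨y, hy, hyx⟩ := exists_lt_of_csInf_lt (hVne ω) h
      rcases hy with rfl | ⟨m, n, rfl, hω⟩
      · exact absurd hx (not_le.2 hyx)
      · exact ⟨m, n, hyx, hω⟩
    · rintro ⟨m, n, hmn, hω⟩
      exact (csInf_le (hVb ω) (Or.inr ⟨m, n, rfl, hω⟩)).trans_lt hmn
  have hU1 : ∀ ω, U ω ≤ 1 := fun ω => csInf_le (hVb ω) (Or.inl rfl)
  have hUm : Measurable U := by
    refine measurable_of_Iio fun x => ?_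
    rcases le_or_gt x 1 with h | h
    · change MeasurableSet {ω | U ω < x}
      rw [hlt x h]
      exact MeasurableSet.iUnion fun m => MeasurableSet.iUnion fun n =>
        MeasurableSet.iUnion fun _ => (hf m n).1
    · convert MeasurableSet.univ
      ext ω
      simpa using (hU1 ω).trans_lt h
  refine ⟨U, isUniform_of_measureReal_lt hUm ?_, ?_⟩
  · rintro x ⟨hx0, hx1⟩
    apply le_antisymm
    · refine le_of_forall_gt_imp_ge_of_dense fun y hy => ?_
      obtain ⟨m, n, h1, h2⟩ := exists_dyadic_between hx0.le hy
      calc P.real {ω | U ω < x} ≤ P.real (f m n) := by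
            refine measureReal_mono ?_
            rw [hlt x hx1.le]
            exact Set.iUnion_subset fun m' => Set.iUnion_subset fun n' => Set.iUnion_subset
              fun h => hnest _ _ _ _ (h.le.trans h1.le)
        _ ≤ n / 2 ^ m := by rw [hmeas]; exact min_le_left _ _
        _ ≤ y := h2.le
    · refine le_of_forall_lt_imp_le_of_dense fun y hy => ?_
      rcases lt_or_ge y 0 with hy0 | hy0
      · exact hy0.le.trans measureReal_nonneg
      obtain ⟨m, n, h1, h2⟩ := exists_dyadic_between hy0 hy
      calc y ≤ n / 2 ^ m := h1.le
        _ = P.real (f m n) := by rw [hmeas, min_eq_left (h2.le.trans hx1.le)]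
        _ ≤ P.real {ω | U ω < x} := by
            refine measureReal_mono ?_
            rw [hlt x hx1.le]
            exact Set.subset_iUnion_of_subset m (Set.subset_iUnion_of_subset n
              (Set.subset_iUnion_of_subset h2 subset_rfl))
  · intro ω ω' h
    obtain ⟨y, hy, hyx⟩ := exists_lt_of_csInf_lt (hVne ω) h
    rcases hy with rfl | ⟨m, n, rfl, hω⟩
    · exact absurd (hU1 ω') (not_le.2 hyx)
    · refine (hf m n).2 ω hω ω' fun h' => ?_
      exact absurd (csInf_le (hVb ω') (Or.inr ⟨m, n, rfl, h'⟩)) (not_le.2 hyx)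

end Comonotone
-- Quantile functions and Average-Value-at-Risk
section Quantile

variable {Ω : Type*} [MeasurableSpace Ω] {P : Measure Ω} [IsProbabilityMeasure P]

theorem measureReal_le_eq_cdf {Y : Ω → ℝ} (hY : AEMeasurable Y P) (x : ℝ) :
    P.real {ω | Y ω ≤ x} = cdf (P.map Y) x := by
  have : IsProbabilityMeasure (P.map Y) := Measure.isProbabilityMeasure_map hY
  rw [cdf_eq_real, Measure.real, Measure.real, Measure.map_apply_of_aemeasurable hY measurableSet_Iic]
  rfl

/-- Right continuity of the distribution function makes the infimum attained; `u ∈ (0, 1)` makes the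
set nonempty and bounded below. -/
theorem quantile_le_iff {Y : Ω → ℝ} (hY : AEMeasurable Y P) {u : ℝ} (hu : u ∈ Set.Ioo (0 : ℝ) 1)
    (x : ℝ) : quantile P Y u ≤ x ↔ u ≤ P.real {ω | Y ω ≤ x} := by
  have : IsProbabilityMeasure (P.map Y) := Measure.isProbabilityMeasure_map hY
  simp only [quantile, measureReal_le_eq_cdf hY]
  set F := cdf (P.map Y)
  have hne : {x | u ≤ F x}.Nonempty := by
    obtain ⟨x, hx⟩ := ((tendsto_cdf_atTop (P.map Y)).eventually (lt_mem_nhds hu.2)).exists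
    exact ⟨x, hx.le⟩
  have hbd : BddBelow {x | u ≤ F x} := by
    obtain ⟨y, hy⟩ := ((tendsto_cdf_atBot (P.map Y)).eventually (gt_mem_nhds hu.1)).exists
    exact ⟨y, fun x hx => not_lt.1 fun h => absurd (F.mono h.le) (not_le.2 (hy.trans_le hx))⟩
  refine ⟨fun h => ?_, fun h => csInf_le hbd h⟩
  have hr : Tendsto F (𝓝[>] x) (𝓝 (F x)) :=
    ((F.right_continuous x).mono_left (nhdsWithin_mono _ Set.Ioi_subset_Ici_self))
  refine ge_of_tendsto hr ?_
  filter_upwards [self_mem_nhdsWithin] with y hy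
  obtain ⟨z, hz, hzy⟩ := exists_lt_of_csInf_lt hne (h.trans_lt hy)
  exact (show u ≤ F z from hz).trans (F.mono hzy.le)

/-- The quantile function of a variable with values in `[-M, M]`, extended monotonically to `ℝ`. -/
noncomputable def extQuantile (P : Measure Ω) (M : ℝ) (Y : Ω → ℝ) (u : ℝ) : ℝ :=
  if u ≤ 0 then -M else if 1 ≤ u then M else quantile P Y u

omit [IsProbabilityMeasure P] in
theorem extQuantile_eq {M : ℝ} {Y : Ω → ℝ} {u : ℝ} (hu : u ∈ Set.Ioo (0 : ℝ) 1) :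
    extQuantile P M Y u = quantile P Y u := by
  rw [extQuantile, if_neg (not_le.2 hu.1), if_neg (not_le.2 hu.2)]

theorem abs_quantile_le {M : ℝ} {Y : Ω → ℝ} (hY : AEMeasurable Y P) (hM : ∀ᵐ ω ∂P, |Y ω| ≤ M)
    {u : ℝ} (hu : u ∈ Set.Ioo (0 : ℝ) 1) : |quantile P Y u| ≤ M := by
  rw [abs_le]
  constructor
  · refine le_of_forall_lt_imp_le_of_dense fun x hx => not_lt.1 fun h => ?_
    have h1 := (quantile_le_iff hY hu x).1 h.le
    have h2 : P.real {ω | Y ω ≤ x} = 0 := by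
      rw [Measure.real, ENNReal.toReal_eq_zero_iff]
      refine Or.inl (measure_eq_zero_iff_ae_notMem.2 ?_)
      filter_upwards [hM] with ω hω h'
      exact absurd (abs_le.1 hω).1 (not_le.2 ((show Y ω ≤ x from h').trans_lt hx))
    linarith [hu.1]
  · rw [quantile_le_iff hY hu]
    have : P.real {ω | Y ω ≤ M} = 1 := by
      rw [Measure.real, ENNReal.toReal_eq_one_iff]
      refine (prob_compl_eq_zero_iff₀ (nullMeasurableSet_le hY aemeasurable_const)).1 ?_
      refine measure_eq_zero_iff_ae_notMem.2 ?_
      filter_upwards [hM] with ω hω h'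
      exact h' (abs_le.1 hω).2
    rw [this]; exact hu.2.le

theorem abs_extQuantile_le {M : ℝ} {Y : Ω → ℝ} (hY : AEMeasurable Y P) (hM : ∀ᵐ ω ∂P, |Y ω| ≤ M)
    (u : ℝ) : |extQuantile P M Y u| ≤ M := by
  obtain ⟨ω, hω⟩ := hM.exists
  have hM0 : 0 ≤ M := (abs_nonneg _).trans hω
  unfold extQuantile
  split_ifs with h1 h2
  · rw [abs_neg, abs_of_nonneg hM0]
  · rw [abs_of_nonneg hM0]
  · exact abs_quantile_le hY hM ⟨not_le.1 h1, not_le.1 h2⟩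

/-- Global monotonicity is the point of the extension: grids also sample at 0, where `quantile`
takes the junk value `sInf univ = 0`. -/
theorem extQuantile_mono {M : ℝ} {Y : Ω → ℝ} (hY : AEMeasurable Y P) (hM : ∀ᵐ ω ∂P, |Y ω| ≤ M) :
    Monotone (extQuantile P M Y) := by
  intro u v huv
  have hu' := abs_le.1 (abs_extQuantile_le hY hM u)
  have hv' := abs_le.1 (abs_extQuantile_le hY hM v)
  by_cases hu0 : u ≤ 0
  · rw [extQuantile, if_pos hu0]; exact hv'.1
  by_cases hv1 : 1 ≤ v
  · have : extQuantile P M Y v = M := by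
      rw [extQuantile, if_neg (by linarith), if_pos hv1]
    rw [this]; exact hu'.2
  have hu : u ∈ Set.Ioo (0 : ℝ) 1 := ⟨not_le.1 hu0, huv.trans_lt (not_le.1 hv1)⟩
  have hv : v ∈ Set.Ioo (0 : ℝ) 1 := ⟨hu.1.trans_le huv, not_le.1 hv1⟩
  rw [extQuantile_eq hu, extQuantile_eq hv, quantile_le_iff hY hu]
  exact huv.trans ((quantile_le_iff hY hv _).1 le_rfl)

/-- Inserting a uniform variable into the quantile function reproduces the distribution. -/
theorem IsUniform.identDistrib_extQuantile {U : Ω → ℝ} (hU : IsUniform P U) {M : ℝ} {Y : Ω → ℝ}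
    (hY : AEMeasurable Y P) (hM : ∀ᵐ ω ∂P, |Y ω| ≤ M) :
    IdentDistrib (fun ω => extQuantile P M Y (U ω)) Y P P := by
  have hm : Measurable fun ω => extQuantile P M Y (U ω) :=
    (extQuantile_mono hY hM).measurable.comp hU.1
  refine ⟨hm.aemeasurable, hY, ?_⟩
  have : IsProbabilityMeasure (P.map fun ω => extQuantile P M Y (U ω)) :=
    Measure.isProbabilityMeasure_map hm.aemeasurable
  have : IsProbabilityMeasure (P.map Y) := Measure.isProbabilityMeasure_map hY
  refine Measure.ext_of_Iic _ _ fun x => ?_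
  rw [Measure.map_apply hm measurableSet_Iic, Measure.map_apply_of_aemeasurable hY measurableSet_Iic,
    ← ofReal_measureReal, ← ofReal_measureReal]
  congr 1
  change P.real {ω | extQuantile P M Y (U ω) ≤ x} = P.real {ω | Y ω ≤ x}
  have h : {ω | extQuantile P M Y (U ω) ≤ x} =ᵐ[P] {ω | U ω ≤ P.real {ω | Y ω ≤ x}} := by
    filter_upwards [hU.ae_mem] with ω hω
    refine propext ?_
    change extQuantile P M Y (U ω) ≤ x ↔ U ω ≤ P.real {ω | Y ω ≤ x}
    rw [extQuantile_eq hω, quantile_le_iff hY hω]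
  rw [measureReal_congr h, hU.measureReal_le, min_eq_left measureReal_le_one,
    max_eq_right measureReal_nonneg]

omit [IsProbabilityMeasure P] in
theorem IsUniform.integral_comp {U : Ω → ℝ} (hU : IsUniform P U) {f : ℝ → ℝ} (hf : Measurable f) :
    ∫ ω, f (U ω) ∂P = ∫ u in (0 : ℝ)..1, f u := by
  rw [intervalIntegral.integral_of_le zero_le_one, ← integral_Ioc_eq_integral_Ioo.symm, ← hU.2,
    integral_map hU.1.aemeasurable hf.aestronglyMeasurable]

omit [IsProbabilityMeasure P] in
theorem avar_eq_extQuantile {M : ℝ} {Y : Ω → ℝ} {α : ℝ} (hα : α ∈ Set.Ico (0 : ℝ) 1) :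
    avar P α Y = (1 / (1 - α)) * ∫ u in α..1, extQuantile P M Y u := by
  rw [avar, intervalIntegral.integral_const_mul, intervalIntegral.integral_of_le hα.2.le,
    intervalIntegral.integral_of_le hα.2.le, integral_Ioc_eq_integral_Ioo,
    integral_Ioc_eq_integral_Ioo]
  congr 1
  refine setIntegral_congr_fun measurableSet_Ioo fun u hu => ?_
  exact (extQuantile_eq ⟨hα.1.trans_lt hu.1, hu.2⟩).symm

theorem abs_avar_le {M : ℝ} {Y : Ω → ℝ} (hY : AEMeasurable Y P) (hM : ∀ᵐ ω ∂P, |Y ω| ≤ M)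
    {α : ℝ} (hα : α ∈ Set.Ico (0 : ℝ) 1) : |avar P α Y| ≤ M := by
  have h1 : 0 < 1 - α := sub_pos.2 hα.2
  rw [avar_eq_extQuantile (M := M) hα, abs_mul, abs_of_pos (one_div_pos.2 h1)]
  have h2 := intervalIntegral.norm_integral_le_of_norm_le_const (a := α) (b := 1)
    (f := extQuantile P M Y) (C := M) fun u _ => abs_extQuantile_le hY hM u
  rw [Real.norm_eq_abs, abs_of_pos h1] at h2
  rw [one_div, inv_mul_le_iff₀ h1, mul_comm]
  exact h2

theorem measurable_avar {M : ℝ} {Y : Ω → ℝ} (hY : AEMeasurable Y P) (hM : ∀ᵐ ω ∂P, |Y ω| ≤ M) :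
    Measurable fun α : Set.Ico (0 : ℝ) 1 => avar P (α : ℝ) Y := by
  have h : (fun α : Set.Ico (0 : ℝ) 1 => avar P (α : ℝ) Y) =
      fun α : Set.Ico (0 : ℝ) 1 => (1 / (1 - (α : ℝ))) * ∫ u in (α : ℝ)..1, extQuantile P M Y u :=
    funext fun α => avar_eq_extQuantile α.2
  rw [h]
  have hc : Continuous fun a : ℝ => ∫ u in a..1, extQuantile P M Y u := by
    simp_rw [intervalIntegral.integral_symm (1 : ℝ)]
    exact (intervalIntegral.continuous_primitive
      (fun a b => (extQuantile_mono hY hM).intervalIntegrable) 1).neg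
  exact (measurable_const.div (measurable_const.sub measurable_subtype_coe)).mul
    (hc.measurable.comp measurable_subtype_coe)

end Quantile
-- Kusuoka's mixing measure and the Hardy–Littlewood inequality
section Kusuoka

variable {Ω : Type*} [MeasurableSpace Ω] {P : Measure Ω} [IsProbabilityMeasure P]

omit [IsProbabilityMeasure P] [MeasurableSpace Ω] in
theorem indicator_lt_slice (D W : Ω → ℝ) (ω : Ω) :
    (fun s => {ω | s < D ω}.indicator W ω) = (Set.Iio (D ω)).indicator fun _ => W ω := by
  ext s
  by_cases h : s < D ω
  · rw [Set.indicator_of_mem (show ω ∈ {ω | s < D ω} from h), Set.indicator_of_mem (Set.mem_Iio.2 h)]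
  · rw [Set.indicator_of_notMem (show ω ∉ {ω | s < D ω} from h),
      Set.indicator_of_notMem (by simpa using h)]

theorem setIntegral_Ioi_indicator_Iio {a : ℝ} (ha : 0 ≤ a) (c : ℝ) :
    ∫ s in Set.Ioi (0 : ℝ), (Set.Iio a).indicator (fun _ => c) s = a * c := by
  rw [integral_indicator measurableSet_Iio, Measure.restrict_restrict measurableSet_Iio,
    show Set.Iio a ∩ Set.Ioi 0 = Set.Ioo 0 a by ext s; exact and_comm,
    setIntegral_const, measureReal_def, Real.volume_Ioo, sub_zero, ENNReal.toReal_ofReal ha,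
    smul_eq_mul]

omit [IsProbabilityMeasure P] in
theorem integrable_uncurry_indicator_lt {D W : Ω → ℝ} (hD : Measurable D) (hD0 : 0 ≤ D)
    (hDi : Integrable D P) (hW : AEStronglyMeasurable W P) {M : ℝ} (hM : ∀ᵐ ω ∂P, |W ω| ≤ M) :
    Integrable (Function.uncurry fun (ω : Ω) (s : ℝ) => {ω | s < D ω}.indicator W ω)
      (P.prod (volume.restrict (Set.Ioi (0 : ℝ)))) := by
  have hset : MeasurableSet {p : Ω × ℝ | p.2 < D p.1} :=
    measurableSet_lt measurable_snd (hD.comp measurable_fst)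
  have heq : (Function.uncurry fun (ω : Ω) (s : ℝ) => {ω | s < D ω}.indicator W ω) =
      {p : Ω × ℝ | p.2 < D p.1}.indicator fun p => W p.1 := rfl
  have hmeas : AEStronglyMeasurable
      (Function.uncurry fun (ω : Ω) (s : ℝ) => {ω | s < D ω}.indicator W ω)
      (P.prod (volume.restrict (Set.Ioi (0 : ℝ)))) := by
    rw [heq]; exact hW.comp_fst.indicator hset
  rw [integrable_prod_iff hmeas]
  refine ⟨Eventually.of_forall fun ω => ?_, ?_⟩
  · change Integrable (fun s => {ω | s < D ω}.indicator W ω) _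
    rw [indicator_lt_slice, integrable_indicator_iff measurableSet_Iio, IntegrableOn,
      Measure.restrict_restrict measurableSet_Iio,
      show Set.Iio (D ω) ∩ Set.Ioi 0 = Set.Ioo 0 (D ω) by ext s; exact and_comm]
    exact integrable_const _
  · have hn : (fun ω => ∫ s in Set.Ioi (0 : ℝ),
        ‖Function.uncurry (fun (ω : Ω) (s : ℝ) => {ω | s < D ω}.indicator W ω) (ω, s)‖) =
        fun ω => ‖W ω‖ * D ω := by
      ext ω
      have hs : ∀ s, ‖{ω | s < D ω}.indicator W ω‖ = (Set.Iio (D ω)).indicator (fun _ => ‖W ω‖) s :=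
        fun s => by rw [← norm_indicator_eq_indicator_norm, ← congrFun (indicator_lt_slice D W ω) s]
      change ∫ s in Set.Ioi (0 : ℝ), ‖{ω | s < D ω}.indicator W ω‖ = _
      rw [integral_congr_ae (Eventually.of_forall hs), setIntegral_Ioi_indicator_Iio (hD0 ω),
        mul_comm]
    rw [hn]
    exact hDi.bdd_mul hW.norm (c := M) (by simpa using hM)

/-- Layer-cake formula: `D` is the integral of `1_{s < D}` over `s > 0`, followed by Fubini. -/
theorem integral_mul_eq_integral_integral_indicator {D W : Ω → ℝ} (hD : Measurable D) (hD0 : 0 ≤ D)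
    (hDi : Integrable D P) (hW : AEStronglyMeasurable W P) {M : ℝ} (hM : ∀ᵐ ω ∂P, |W ω| ≤ M) :
    ∫ ω, D ω * W ω ∂P = ∫ s in Set.Ioi (0 : ℝ), ∫ ω, {ω | s < D ω}.indicator W ω ∂P := by
  rw [← integral_integral_swap (integrable_uncurry_indicator_lt hD hD0 hDi hW hM)]
  refine integral_congr_ae (Eventually.of_forall fun ω => ?_)
  change D ω * W ω = ∫ s in Set.Ioi (0 : ℝ), (fun s => {ω | s < D ω}.indicator W ω) s
  rw [indicator_lt_slice, setIntegral_Ioi_indicator_Iio (hD0 ω)]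

/-- Restriction of a real number to `[0, 1)`, with value `0` outside. -/
noncomputable def clampIco (x : ℝ) : Set.Ico (0 : ℝ) 1 :=
  ⟨Set.indicator (Set.Ico 0 1) id x, by
    by_cases h : x ∈ Set.Ico (0 : ℝ) 1
    · rwa [Set.indicator_of_mem h]
    · rw [Set.indicator_of_notMem h]; exact ⟨le_rfl, zero_lt_one⟩⟩

theorem measurable_clampIco : Measurable clampIco :=
  (measurable_id.indicator measurableSet_Ico).subtype_mk

theorem clampIco_coe {x : ℝ} (h : x ∈ Set.Ico (0 : ℝ) 1) : (clampIco x : ℝ) = x :=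
  Set.indicator_of_mem h _

/-- The mixing measure in Kusuoka's representation belonging to the density `D`: the law of
`F_D(s)` when `s` is distributed on `(0, ∞)` with density `P[D > s]`. -/
noncomputable def kusuokaMeasure (P : Measure Ω) (D : Ω → ℝ) : Measure (Set.Ico (0 : ℝ) 1) :=
  ((volume.restrict (Set.Ioi (0 : ℝ))).withDensity fun s => P {ω | s < D ω}).map
    fun s => clampIco (P.real {ω | D ω ≤ s})

theorem measurable_measureReal_le (D : Ω → ℝ) : Measurable fun s => P.real {ω | D ω ≤ s} :=
  Monotone.measurable fun _ _ hst => measureReal_mono fun _ h => le_trans h hst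

theorem measurable_clampIco_measureReal_le (D : Ω → ℝ) :
    Measurable fun s => clampIco (P.real {ω | D ω ≤ s}) :=
  measurable_clampIco.comp (measurable_measureReal_le D)

omit [IsProbabilityMeasure P] in
theorem measurable_measure_lt (D : Ω → ℝ) : Measurable fun s => P {ω | s < D ω} :=
  Antitone.measurable fun _ _ hst => measure_mono fun _ h => lt_of_le_of_lt hst h

theorem isProbabilityMeasure_kusuokaMeasure {D : Ω → ℝ} (hD : Measurable D) (hD0 : 0 ≤ D)
    (hDi : Integrable D P) (hD1 : ∫ ω, D ω ∂P = 1) : IsProbabilityMeasure (kusuokaMeasure P D) := by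
  have : IsProbabilityMeasure
      ((volume.restrict (Set.Ioi (0 : ℝ))).withDensity fun s => P {ω | s < D ω}) := by
    refine ⟨?_⟩
    rw [withDensity_apply _ MeasurableSet.univ, Measure.restrict_univ,
      ← lintegral_eq_lintegral_meas_lt P (Eventually.of_forall hD0) hD.aemeasurable,
      ← ofReal_integral_eq_lintegral_ofReal hDi (Eventually.of_forall hD0), hD1, ENNReal.ofReal_one]
  exact Measure.isProbabilityMeasure_map
    (measurable_clampIco_measureReal_le D).aemeasurable

omit [IsProbabilityMeasure P] in
theorem indicator_lt_ae_eq {D U : Ω → ℝ} (hDU : IsComonotone P D U) (g : ℝ → ℝ) (s : ℝ) :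
    {ω | s < D ω}.indicator (fun ω => g (U ω)) =ᵐ[P]
      fun ω => (Set.Ioi (P.real {ω | D ω ≤ s})).indicator g (U ω) := by
  have h1 : {ω | s < D ω} =ᵐ[P] U ⁻¹' (Set.Ioi (P.real {ω | D ω ≤ s})) := by
    filter_upwards [hDU s] with ω hω
    exact propext ((not_le (a := D ω)).symm.trans ((not_congr (iff_of_eq hω)).trans
      (not_le (a := U ω))))
  exact indicator_ae_eq_of_ae_eq_set h1

/-- Layer by layer: with `p = F_D(s)`, the layer `{D > s}` is almost surely `{U > p}`, and it
contributes `∫_p^1 q_Y = (1 - p) AV@R_p(Y)`, where `1 - p = P[D > s]` is the weight of `s`. -/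
theorem integral_kusuokaMeasure {D U : Ω → ℝ} (hD : Measurable D) (hD0 : 0 ≤ D)
    (hDi : Integrable D P) (hU : IsUniform P U) (hDU : IsComonotone P D U) {Y : Ω → ℝ}
    (hY : AEMeasurable Y P) {M : ℝ} (hM : ∀ᵐ ω ∂P, |Y ω| ≤ M) :
    ∫ α, avar P (α : ℝ) Y ∂(kusuokaMeasure P D) = ∫ ω, D ω * extQuantile P M Y (U ω) ∂P := by
  have hg := (extQuantile_mono hY hM).measurable
  rw [integral_mul_eq_integral_integral_indicator hD hD0 hDi
    (show Measurable fun ω => extQuantile P M Y (U ω) from hg.comp hU.1).aestronglyMeasurable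
    (Eventually.of_forall fun ω => abs_extQuantile_le hY hM (U ω)), kusuokaMeasure,
    integral_map (measurable_clampIco_measureReal_le D).aemeasurable
      (measurable_avar hY hM).aestronglyMeasurable,
    integral_withDensity_eq_integral_toReal_smul (measurable_measure_lt D)
      (Eventually.of_forall fun s => measure_lt_top _ _)]
  refine integral_congr_ae (Eventually.of_forall fun s => ?_)
  set p := P.real {ω | D ω ≤ s} with hp
  have hp0 : 0 ≤ p := measureReal_nonneg
  have hp1 : p ≤ 1 := measureReal_le_one
  have hcompl : {ω | s < D ω} = {ω | D ω ≤ s}ᶜ := by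
    ext ω; exact (not_le (a := D ω)).symm
  have hlt : (P {ω | s < D ω}).toReal = 1 - p := by
    rw [hcompl]; exact probReal_compl_eq_one_sub (measurableSet_le hD measurable_const)
  change (P {ω | s < D ω}).toReal • avar P (clampIco p : ℝ) Y =
    ∫ ω, {ω | s < D ω}.indicator (fun ω => extQuantile P M Y (U ω)) ω ∂P
  have h2 : ∫ u in (0 : ℝ)..1, (Set.Ioi p).indicator (extQuantile P M Y) u =
      ∫ u in p..1, extQuantile P M Y u := by
    rw [intervalIntegral.integral_of_le zero_le_one, intervalIntegral.integral_of_le hp1,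
      setIntegral_indicator measurableSet_Ioi]
    congr 2
    ext u
    exact ⟨fun h => ⟨h.2, h.1.2⟩, fun h => ⟨⟨hp0.trans_lt h.1, h.2⟩, h.1⟩⟩
  rw [integral_congr_ae (indicator_lt_ae_eq hDU _ s), ← hp,
    hU.integral_comp (hg.indicator measurableSet_Ioi), hlt, h2, smul_eq_mul]
  -- At `p = 1` the weight vanishes, so the default value of `clampIco` is harmless.
  rcases hp1.eq_or_lt with h | h
  · rw [h]; simp
  · rw [clampIco_coe ⟨hp0, h⟩, avar_eq_extQuantile (M := M) ⟨hp0, h⟩]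
    have : 1 - p ≠ 0 := (sub_pos.2 h).ne'
    field_simp

/-- The Hardy–Littlewood inequality. -/
theorem integral_mul_le_integral_mul_extQuantile {D U : Ω → ℝ} (hD : Measurable D) (hD0 : 0 ≤ D)
    (hDi : Integrable D P) (hU : IsUniform P U) (hDU : IsComonotone P D U) {Y : Ω → ℝ}
    (hY : AEMeasurable Y P) {M : ℝ} (hM : ∀ᵐ ω ∂P, |Y ω| ≤ M) :
    ∫ ω, D ω * Y ω ∂P ≤ ∫ ω, D ω * extQuantile P M Y (U ω) ∂P := by
  have hmono := extQuantile_mono hY hM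
  have hg := hmono.measurable
  have hgb := abs_extQuantile_le hY hM
  have hgU : Measurable fun ω => extQuantile P M Y (U ω) := hg.comp hU.1
  have hUb : ∀ᵐ ω ∂P, |extQuantile P M Y (U ω)| ≤ M := Eventually.of_forall fun ω => hgb (U ω)
  rw [integral_mul_eq_integral_integral_indicator hD hD0 hDi hY.aestronglyMeasurable hM,
    integral_mul_eq_integral_integral_indicator hD hD0 hDi hgU.aestronglyMeasurable hUb]
  refine setIntegral_mono
    (integrable_uncurry_indicator_lt hD hD0 hDi hY.aestronglyMeasurable hM).integral_prod_right
    (integrable_uncurry_indicator_lt hD hD0 hDi hgU.aestronglyMeasurable hUb).integral_prod_right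
    fun s => ?_
  change ∫ ω, {ω | s < D ω}.indicator Y ω ∂P ≤
    ∫ ω, {ω | s < D ω}.indicator (fun ω => extQuantile P M Y (U ω)) ω ∂P
  set p := P.real {ω | D ω ≤ s} with hp
  set r := extQuantile P M Y p
  have hA : MeasurableSet {ω | s < D ω} := measurableSet_lt measurable_const hD
  have hYi : Integrable Y P := Integrable.of_bound hY.aestronglyMeasurable M hM
  have hgi : Integrable (fun ω => extQuantile P M Y (U ω)) P :=
    Integrable.of_bound hgU.aestronglyMeasurable M hUb
  have hri : Integrable ({ω | s < D ω}.indicator fun _ => r) P :=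
    (integrable_const r).indicator hA
  have hY' : Integrable (fun ω => max (Y ω - r) 0) P := (hYi.sub (integrable_const r)).pos_part
  have hg' : Integrable (fun ω => max (extQuantile P M Y (U ω) - r) 0) P :=
    (hgi.sub (integrable_const r)).pos_part
  have hid : ∫ ω, max (Y ω - r) 0 ∂P = ∫ ω, max (extQuantile P M Y (U ω) - r) 0 ∂P :=
    (((hU.identDistrib_extQuantile hY hM).comp
      (show Measurable fun y : ℝ => max (y - r) 0 by fun_prop)).integral_eq).symm
  -- The bound `1_A Y ≤ r 1_A + (Y - r)⁺` is an equality for the rearrangement, because its quantile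
  -- level exceeds `p` exactly on `A` up to a null set; the last term depends on the law of `Y`
  -- only.
  calc ∫ ω, {ω | s < D ω}.indicator Y ω ∂P
      ≤ ∫ ω, ({ω | s < D ω}.indicator (fun _ => r) ω + max (Y ω - r) 0) ∂P := by
        refine integral_mono (hYi.indicator hA) (hri.add hY') fun ω => ?_
        by_cases h : ω ∈ {ω | s < D ω}
        · simp only [Set.indicator_of_mem h]
          linarith [le_max_left (Y ω - r) 0]
        · simp only [Set.indicator_of_notMem h, zero_add]
          exact le_max_right _ _
    _ = ∫ ω, ({ω | s < D ω}.indicator (fun _ => r) ω + max (extQuantile P M Y (U ω) - r) 0) ∂P := by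
        rw [integral_add hri hY', integral_add hri hg', hid]
    _ = ∫ ω, {ω | s < D ω}.indicator (fun ω => extQuantile P M Y (U ω)) ω ∂P := by
        refine integral_congr_ae ?_
        filter_upwards [indicator_lt_ae_eq hDU (extQuantile P M Y) s,
          indicator_lt_ae_eq hDU (fun _ => r) s] with ω h1 h2
        rw [h1, h2, ← hp]
        by_cases h : U ω ∈ Set.Ioi p
        · rw [Set.indicator_of_mem h, Set.indicator_of_mem h,
            max_eq_left (sub_nonneg.2 (hmono (Set.mem_Ioi.1 h).le))]
          ring
        · rw [Set.indicator_of_notMem h, Set.indicator_of_notMem h,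
            max_eq_right (sub_nonpos.2 (hmono (not_lt.1 h))), zero_add]

end Kusuoka
-- Passage to the log scale
section LogScale

variable {Ω : Type*} [MeasurableSpace Ω] {P : Measure Ω} [IsProbabilityMeasure P]

omit [IsProbabilityMeasure P] in
theorem exists_ae_abs_le {W : Ω → ℝ} (hW : MemLp W ∞ P) : ∃ M : ℝ, ∀ᵐ ω ∂P, |W ω| ≤ M := by
  refine ⟨(eLpNorm W ∞ P).toReal, ?_⟩
  have h := ae_le_eLpNormEssSup (f := W) (μ := P)
  filter_upwards [h] with ω hω
  rw [← eLpNorm_exponent_top] at hω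
  have := (ENNReal.toReal_le_toReal enorm_ne_top hW.2.ne).2 hω
  simpa using this

omit [IsProbabilityMeasure P] in
theorem memLp_top_of_abs_le {W : Ω → ℝ} (hW : AEMeasurable W P) {M : ℝ}
    (hM : ∀ᵐ ω ∂P, |W ω| ≤ M) : MemLp W ∞ P :=
  memLp_top_of_bound hW.aestronglyMeasurable M hM

omit [IsProbabilityMeasure P] in
theorem memLinfPP_exp {W : Ω → ℝ} (hW : MemLp W ∞ P) :
    MemLinfPP P fun ω => Real.exp (W ω) := by
  obtain ⟨M, hM⟩ := exists_ae_abs_le hW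
  refine ⟨memLp_top_of_abs_le (Real.measurable_exp.comp_aemeasurable hW.1.aemeasurable)
    (M := Real.exp M) ?_, Real.exp (-M), Real.exp_pos _, ?_⟩
  · filter_upwards [hM] with ω hω
    rw [Real.abs_exp]
    exact Real.exp_le_exp.2 (abs_le.1 hω).2
  · filter_upwards [hM] with ω hω
    exact Real.exp_le_exp.2 (abs_le.1 hω).1

omit [IsProbabilityMeasure P] in
theorem MemLinfPP.memLp_log {X : Ω → ℝ} (hX : MemLinfPP P X) :
    MemLp (fun ω => Real.log (X ω)) ∞ P := by
  obtain ⟨M, hM⟩ := exists_ae_abs_le hX.1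
  obtain ⟨c, hc, hcX⟩ := hX.2
  refine memLp_top_of_abs_le (Real.measurable_log.comp_aemeasurable hX.1.1.aemeasurable)
    (M := max (Real.log M) (-Real.log c)) ?_
  filter_upwards [hM, hcX] with ω h1 h2
  have h3 : 0 < X ω := hc.trans_le h2
  refine abs_le.2 ⟨?_, ?_⟩
  · have := Real.log_le_log hc h2
    linarith [le_max_right (Real.log M) (-Real.log c)]
  · exact (Real.log_le_log h3 ((le_abs_self _).trans h1)).trans (le_max_left _ _)

omit [IsProbabilityMeasure P] in
theorem MemLinfPP.exp_log_ae_eq {X : Ω → ℝ} (hX : MemLinfPP P X) :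
    (fun ω => Real.exp (Real.log (X ω))) =ᵐ[P] X := by
  obtain ⟨c, hc, hcX⟩ := hX.2
  filter_upwards [hcX] with ω h
  exact Real.exp_log (hc.trans_le h)

/-- Monotone, quasi-convex, law-invariant functionals on `L^∞` that are continuous from below. -/
structure IsLawInvariantRisk (P : Measure Ω) (ψ : (Ω → ℝ) → ℝ≥0∞) : Prop where
  mono : ∀ W V : Ω → ℝ, MemLp W ∞ P → MemLp V ∞ P → W ≤ᵐ[P] V → ψ W ≤ ψ V
  quasiconvex : ∀ W V : Ω → ℝ, MemLp W ∞ P → MemLp V ∞ P → ∀ a : ℝ, 0 < a → a < 1 →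
    ψ (fun ω => a * W ω + (1 - a) * V ω) ≤ max (ψ W) (ψ V)
  continuous : ∀ (W : ℕ → Ω → ℝ) (V : Ω → ℝ), (∀ n, MemLp (W n) ∞ P) → MemLp V ∞ P →
    (∀ n, W n ≤ᵐ[P] W (n + 1)) → (∀ᵐ ω ∂P, Tendsto (fun n => W n ω) atTop (𝓝 (V ω))) →
    Tendsto (fun n => ψ (W n)) atTop (𝓝 (ψ V))
  law : ∀ W V : Ω → ℝ, MemLp W ∞ P → MemLp V ∞ P → IdentDistrib W V P P → ψ W = ψ V

omit [IsProbabilityMeasure P] in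
theorem isLawInvariantRisk_exp {ρ : (Ω → ℝ) → ℝ≥0∞} (h1 : IsMonotone P ρ)
    (h2 : IsQuasiLogconvex P ρ) (h3 : IsContinuousFromBelow P ρ) (h4 : IsLawInvariant P ρ) :
    IsLawInvariantRisk P fun W => ρ fun ω => Real.exp (W ω) where
  mono W V hW hV h := h1 _ _ (memLinfPP_exp hW) (memLinfPP_exp hV) (by
    filter_upwards [h] with ω hω using Real.exp_le_exp.2 hω)
  quasiconvex W V hW hV a ha ha1 := by
    have := h2 _ _ (memLinfPP_exp hW) (memLinfPP_exp hV) a ha ha1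
    simpa only [← Real.exp_mul, ← Real.exp_add, mul_comm (W _), mul_comm (V _)] using this
  continuous W V hW hV hWn hlim := h3 _ _ (fun n => memLinfPP_exp (hW n)) (memLinfPP_exp hV)
    (fun n => by filter_upwards [hWn n] with ω hω using Real.exp_le_exp.2 hω)
    (by filter_upwards [hlim] with ω hω using (Real.continuous_exp.tendsto _).comp hω)
  law W V hW hV h := h4 _ _ (memLinfPP_exp hW) (memLinfPP_exp hV) (h.comp Real.measurable_exp)

omit [IsProbabilityMeasure P] in
theorem IsMonotone.exp_log_eq {ρ : (Ω → ℝ) → ℝ≥0∞} (h1 : IsMonotone P ρ) {X : Ω → ℝ}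
    (hX : MemLinfPP P X) : ρ (fun ω => Real.exp (Real.log (X ω))) = ρ X :=
  le_antisymm (h1 _ _ (memLinfPP_exp hX.memLp_log) hX hX.exp_log_ae_eq.le)
    (h1 _ _ hX (memLinfPP_exp hX.memLp_log) hX.exp_log_ae_eq.symm.le)

/-- Continuity from below along `W - 1/(n+1)`. The slack `ε` later yields the open orthant for
Hahn–Banach and absorbs discretization errors. -/
theorem IsLawInvariantRisk.exists_lt_sub {ψ : (Ω → ℝ) → ℝ≥0∞} (hψ : IsLawInvariantRisk P ψ)
    {W : Ω → ℝ} (hW : MemLp W ∞ P) {c : ℝ≥0∞} (hc : c < ψ W) :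
    ∃ ε : ℝ, 0 < ε ∧ c < ψ fun ω => W ω - ε := by
  have hlim : Tendsto (fun n : ℕ => 1 / ((n : ℝ) + 1)) atTop (𝓝 0) :=
    tendsto_one_div_add_atTop_nhds_zero_nat
  have h := hψ.continuous (fun n ω => W ω - 1 / ((n : ℝ) + 1)) W
    (fun n => hW.sub (memLp_const _)) hW
    (fun n => Eventually.of_forall fun ω => sub_le_sub_left
      (one_div_le_one_div_of_le (by positivity) (by push_cast; linarith)) _)
    (Eventually.of_forall fun ω => by simpa using hlim.const_sub (W ω))
  obtain ⟨n, hn⟩ := (h.eventually (lt_mem_nhds hc)).exists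
  exact ⟨1 / ((n : ℝ) + 1), by positivity, hn⟩

end LogScale

/-! ### Functions that are constant on the cells of a uniform grid -/

section Grid

/-- The index of the cell of the uniform grid with `n` cells on `[0, 1)` that contains `u`. -/
noncomputable def gridIdx (n : ℕ) [NeZero n] (u : ℝ) : Fin n :=
  ⟨min ⌊n * u⌋₊ (n - 1), (min_le_right _ _).trans_lt (Nat.sub_lt (NeZero.pos n) one_pos)⟩

theorem gridIdx_val {n : ℕ} [NeZero n] {u : ℝ} (hu : u ∈ Set.Ioo (0 : ℝ) 1) :
    (gridIdx n u : ℕ) = ⌊n * u⌋₊ := by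
  have hn : (0 : ℝ) < n := by exact_mod_cast NeZero.pos n
  refine min_eq_left (Nat.le_sub_one_of_lt ?_)
  rw [Nat.floor_lt (by have := hu.1; positivity)]
  nlinarith [hu.2]

theorem gridIdx_mono (n : ℕ) [NeZero n] : Monotone (gridIdx n) := fun u v h =>
  Fin.mk_le_mk.2 (min_le_min_right _ (Nat.floor_mono (mul_le_mul_of_nonneg_left h (by positivity))))

theorem measurable_gridIdx (n : ℕ) [NeZero n] : Measurable (gridIdx n) := by
  have h : Measurable fun u : ℝ => min ⌊n * u⌋₊ (n - 1) := by
    have := (Nat.measurable_floor (R := ℝ)).comp (measurable_const_mul (n : ℝ))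
    exact this.min measurable_const
  refine measurable_to_countable' fun i => ?_
  convert h (measurableSet_singleton (i : ℕ)) using 1
  ext u
  simp [gridIdx, Fin.ext_iff]

theorem gridIdx_eq_iff {n : ℕ} [NeZero n] {u : ℝ} (hu : u ∈ Set.Ioo (0 : ℝ) 1) (i : Fin n) :
    gridIdx n u = i ↔ (i / n : ℝ) ≤ u ∧ u < (i + 1) / n := by
  have hn : (0 : ℝ) < n := by exact_mod_cast NeZero.pos n
  rw [Fin.ext_iff, gridIdx_val hu, Nat.floor_eq_iff (by have := hu.1; positivity),
    div_le_iff₀ hn, lt_div_iff₀ hn, mul_comm u]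

variable {Ω : Type*} [MeasurableSpace Ω] {P : Measure Ω} [IsProbabilityMeasure P]

theorem IsUniform.measureReal_gridIdx {U : Ω → ℝ} (hU : IsUniform P U) (n : ℕ) [NeZero n]
    (i : Fin n) : P.real {ω | gridIdx n (U ω) = i} = 1 / n := by
  have hn : (0 : ℝ) < n := by exact_mod_cast NeZero.pos n
  have hi : (i : ℝ) + 1 ≤ n := by exact_mod_cast i.2
  have hi0 : (0 : ℝ) ≤ i := by positivity
  have h1 : {ω | gridIdx n (U ω) = i} =ᵐ[P]
      ({ω | U ω < (i + 1) / n} \ {ω | U ω < i / n} : Set Ω) := by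
    filter_upwards [hU.ae_mem] with ω hω
    refine propext ((gridIdx_eq_iff hω i).trans ⟨fun h => ⟨h.2, not_lt.2 h.1⟩,
      fun h => ⟨not_lt.1 h.2, h.1⟩⟩)
  have hle : (i / n : ℝ) ≤ (i + 1) / n := by gcongr; linarith
  rw [measureReal_congr h1, measureReal_sdiff
    (show {ω | U ω < i / n} ⊆ {ω | U ω < (i + 1) / n} from fun ω h => lt_of_lt_of_le h hle)
    (measurableSet_lt hU.1 measurable_const), hU.measureReal_lt, hU.measureReal_lt,
    min_eq_left, min_eq_left, max_eq_right, max_eq_right]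
  · field_simp; ring
  · positivity
  · positivity
  · rw [div_le_one hn]; linarith
  · rwa [div_le_one hn]

theorem measurable_comp_gridIdx {U : Ω → ℝ} (hU : Measurable U) {n : ℕ} [NeZero n]
    (y : Fin n → ℝ) : Measurable fun ω => y (gridIdx n (U ω)) :=
  (measurable_of_countable y).comp ((measurable_gridIdx n).comp hU)

omit [IsProbabilityMeasure P] in
theorem memLp_comp_gridIdx {U : Ω → ℝ} (hU : Measurable U) {n : ℕ} [NeZero n] (y : Fin n → ℝ) :
    MemLp (fun ω => y (gridIdx n (U ω))) ∞ P :=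
  memLp_top_of_abs_le (measurable_comp_gridIdx hU y).aemeasurable (M := ∑ i, |y i|)
    (Eventually.of_forall fun _ => Finset.single_le_sum (f := fun i => |y i|)
      (fun _ _ => abs_nonneg _) (Finset.mem_univ _))

/-- All cells have mass `1/n`, so law invariance of `ψ` becomes permutation invariance in `ℝ^n`. -/
theorem IsUniform.identDistrib_perm {U : Ω → ℝ} (hU : IsUniform P U) {n : ℕ} [NeZero n]
    (σ : Equiv.Perm (Fin n)) (y : Fin n → ℝ) :
    IdentDistrib (fun ω => y (σ (gridIdx n (U ω)))) (fun ω => y (gridIdx n (U ω))) P P := by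
  have hm : Measurable fun ω => gridIdx n (U ω) := (measurable_gridIdx n).comp hU.1
  have hσ : Measurable fun ω => σ (gridIdx n (U ω)) := (measurable_of_countable σ).comp hm
  have h : IdentDistrib (fun ω => σ (gridIdx n (U ω))) (fun ω => gridIdx n (U ω)) P P := by
    refine ⟨hσ.aemeasurable, hm.aemeasurable, Measure.ext_of_singleton fun i => ?_⟩
    rw [Measure.map_apply hσ (measurableSet_singleton i),
      Measure.map_apply hm (measurableSet_singleton i),
      ← ofReal_measureReal, ← ofReal_measureReal]
    congr 1
    refine Eq.trans ?_ (hU.measureReal_gridIdx n i).symm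
    rw [← hU.measureReal_gridIdx n (σ.symm i)]
    congr 1
    ext ω
    exact (Equiv.eq_symm_apply σ).symm
  exact h.comp (measurable_of_countable y)

variable {ψ : (Ω → ℝ) → ℝ≥0∞}

/-- Grid functions at risk level at most `c`. -/
def gridSublevel (ψ : (Ω → ℝ) → ℝ≥0∞) (U : Ω → ℝ) (n : ℕ) [NeZero n] (c : ℝ≥0∞) :
    Set (Fin n → ℝ) :=
  {y | ψ (fun ω => y (gridIdx n (U ω))) ≤ c}

omit [IsProbabilityMeasure P] in
theorem IsLawInvariantRisk.convex_gridSublevel (hψ : IsLawInvariantRisk P ψ) {U : Ω → ℝ}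
    (hU : Measurable U) (n : ℕ) [NeZero n] (c : ℝ≥0∞) : Convex ℝ (gridSublevel ψ U n c) := by
  intro y hy z hz a b ha hb hab
  rcases ha.eq_or_lt with rfl | ha
  · rw [zero_add] at hab; subst hab; simpa using hz
  rcases hb.eq_or_lt with rfl | hb
  · rw [add_zero] at hab; subst hab; simpa using hy
  obtain rfl : b = 1 - a := by linarith
  exact (hψ.quasiconvex _ _ (memLp_comp_gridIdx hU y) (memLp_comp_gridIdx hU z) a ha
    (by linarith)).trans (max_le hy hz)

theorem IsLawInvariantRisk.comp_perm_mem_gridSublevel (hψ : IsLawInvariantRisk P ψ) {U : Ω → ℝ}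
    (hU : IsUniform P U) {n : ℕ} [NeZero n] {c : ℝ≥0∞} {y : Fin n → ℝ}
    (hy : y ∈ gridSublevel ψ U n c) (σ : Equiv.Perm (Fin n)) : y ∘ σ ∈ gridSublevel ψ U n c :=
  (hψ.law _ _ (memLp_comp_gridIdx hU.1 _) (memLp_comp_gridIdx hU.1 _)
    (hU.identDistrib_perm σ y)).trans_le hy

end Grid
-- Averaging over grid cells does not increase the risk
section Averaging

/-- The mean of `g` over a cell of the uniform grid. -/
noncomputable def cellMean (n : ℕ) (g : ℝ → ℝ) (i : Fin n) : ℝ :=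
  n * ∫ u in (i / n : ℝ)..((i + 1) / n : ℝ), g u

/-- For monotone `g` the right Riemann sum dominates the integral, and it exceeds the left one by a
telescoping difference of at most `2M/k`. Rescaling turns the `k` subcells into unit intervals. -/
theorem cellMean_le_mean_add {n k : ℕ} [NeZero n] [NeZero k] {g : ℝ → ℝ} (hg : Monotone g) {M : ℝ}
    (hM : ∀ u, |g u| ≤ M) (i : Fin n) :
    cellMean n g i ≤ (∑ j : Fin k, (1 / k : ℝ) * g ((j + k * i) / (n * k))) + 2 * M / k := by
  have hn : (0 : ℝ) < n := by exact_mod_cast NeZero.pos n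
  have hk : (0 : ℝ) < k := by exact_mod_cast NeZero.pos k
  have hnk : (n * k : ℝ) ≠ 0 := by positivity
  set h : ℝ → ℝ := fun t => g (t / (n * k) + i / n) with hh
  have hmono : Monotone h := fun s t hst => hg (by gcongr)
  have h1 : ∫ t in (0 : ℝ)..k, h t = (n * k) * ∫ u in (i / n : ℝ)..((i + 1) / n : ℝ), g u := by
    rw [hh, intervalIntegral.integral_comp_div_add g hnk, smul_eq_mul]
    congr 2
    · simp
    · field_simp; ring
  have h2 := (hmono.monotoneOn (Set.Icc 0 (0 + (k : ℝ)))).integral_le_sum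
  have h3 : ∑ j ∈ Finset.range k, h (0 + ((j + 1 : ℕ) : ℝ)) + h (0 : ℕ) =
      ∑ j ∈ Finset.range k, h (j : ℕ) + h (k : ℕ) := by
    rw [← Finset.sum_range_succ, Finset.sum_range_succ']
    simp
  rw [zero_add] at h2
  have h4 : ∑ j : Fin k, (1 / k : ℝ) * g ((j + k * i) / (n * k)) =
      (1 / k) * ∑ j ∈ Finset.range k, h (j : ℕ) := by
    rw [Finset.mul_sum, ← Fin.sum_univ_eq_sum_range (fun j => (1 / k : ℝ) * h j)]
    refine Finset.sum_congr rfl fun j _ => ?_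
    simp only [hh]
    congr 2
    field_simp
  have h5 := (abs_le.1 (hM ((0 : ℕ) / (n * k) + i / n))).1
  have h6 := (abs_le.1 (hM ((k : ℕ) / (n * k) + i / n))).2
  have h7 : n * ∫ u in (i / n : ℝ)..((i + 1) / n : ℝ), g u = (∫ t in (0 : ℝ)..k, h t) / k := by
    rw [h1]; field_simp
  rw [cellMean, h4, h7, one_div, inv_mul_eq_div, ← add_div]
  refine div_le_div_of_nonneg_right ?_ hk.le
  have h8 : -M ≤ h (0 : ℕ) := h5
  have h9 : h (k : ℕ) ≤ M := h6
  linarith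

theorem cellMean_ge {n : ℕ} [NeZero n] {g : ℝ → ℝ} (hg : Monotone g) (i : Fin n) :
    g (i / n) ≤ cellMean n g i := by
  have hn : (0 : ℝ) < n := by exact_mod_cast NeZero.pos n
  have hle : (i / n : ℝ) ≤ (i + 1) / n := by gcongr; linarith
  have h := intervalIntegral.integral_mono_on hle (μ := volume) (f := fun _ => g (i / n)) (g := g)
    intervalIntegrable_const hg.intervalIntegrable fun u hu => hg hu.1
  rw [intervalIntegral.integral_const, smul_eq_mul] at h
  calc g (i / n) = n * (((i + 1) / n - i / n) * g (i / n)) := by field_simp; ring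
    _ ≤ _ := mul_le_mul_of_nonneg_left h hn.le

/-- Cyclic shift by `s` within consecutive blocks of length `k`. -/
def blockShift (n k : ℕ) [NeZero k] (s : Fin k) : Equiv.Perm (Fin (n * k)) :=
  finProdFinEquiv.symm.trans
    (((Equiv.refl (Fin n)).prodCongr (Equiv.addRight s)).trans finProdFinEquiv)

/-- The `k` cyclic shifts carry a given index to each position of its block exactly once. -/
theorem sum_blockShift {n k : ℕ} [NeZero k] (v : Fin (n * k) → ℝ) (l : Fin (n * k)) :
    ∑ s : Fin k, (1 / k : ℝ) * v (blockShift n k s l) =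
      ∑ j : Fin k, (1 / k : ℝ) * v (finProdFinEquiv (l.divNat, j)) := by
  refine Equiv.sum_comp (Equiv.addLeft l.modNat) fun j : Fin k =>
    (1 / k : ℝ) * v (finProdFinEquiv (l.divNat, j))

variable {Ω : Type*} [MeasurableSpace Ω] {P : Measure Ω} [IsProbabilityMeasure P]
  {ψ : (Ω → ℝ) → ℝ≥0∞}

theorem gridIdx_mul_divNat {n k : ℕ} [NeZero n] [NeZero k] {u : ℝ} (hu : u ∈ Set.Ioo (0 : ℝ) 1) :
    (gridIdx (n * k) u).divNat = gridIdx n u := by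
  have hk : (k : ℝ) ≠ 0 := by exact_mod_cast NeZero.ne k
  rw [Fin.ext_iff, Fin.coe_divNat, gridIdx_val hu, gridIdx_val hu, ← Nat.floor_div_natCast]
  congr 1
  push_cast
  field_simp

theorem gridIdx_div_le {n : ℕ} [NeZero n] {u : ℝ} (hu : u ∈ Set.Ioo (0 : ℝ) 1) :
    ((gridIdx n u : ℕ) / n : ℝ) ≤ u :=
  ((gridIdx_eq_iff hu _).1 rfl).1

/-- Averaging the quantile function over the cells of a grid does not increase the risk. -/
theorem IsLawInvariantRisk.cellMean_extQuantile_le (hψ : IsLawInvariantRisk P ψ) {U : Ω → ℝ}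
    (hU : IsUniform P U) {Y : Ω → ℝ} (hY : MemLp Y ∞ P) {M : ℝ} (hM : ∀ᵐ ω ∂P, |Y ω| ≤ M)
    (n : ℕ) [NeZero n] :
    ψ (fun ω => cellMean n (extQuantile P M Y) (gridIdx n (U ω))) ≤ ψ Y := by
  set g := extQuantile P M Y with hgdef
  have hg : Monotone g := extQuantile_mono hY.1.aemeasurable hM
  have hgM : ∀ u, |g u| ≤ M := abs_extQuantile_le hY.1.aemeasurable hM
  have hgU : MemLp (fun ω => g (U ω)) ∞ P :=
    memLp_top_of_abs_le (hg.measurable.comp hU.1).aemeasurable (Eventually.of_forall fun ω => hgM _)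
  have hYg : ψ (fun ω => g (U ω)) = ψ Y :=
    hψ.law _ _ hgU hY (hU.identDistrib_extQuantile hY.1.aemeasurable hM)
  refine not_lt.1 fun hlt => ?_
  obtain ⟨ε, hε, hltε⟩ := hψ.exists_lt_sub (memLp_comp_gridIdx hU.1 (cellMean n g)) hlt
  obtain ⟨k, hk⟩ := exists_nat_gt (max 1 (2 * M / ε))
  have hk0 : (0 : ℝ) < k := (zero_lt_one.trans_le (le_max_left _ _)).trans hk
  have : NeZero k := ⟨by rintro rfl; simp at hk0⟩
  have hkε : 2 * M / k ≤ ε := by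
    have := ((le_max_right _ _).trans_lt hk).le
    rw [div_le_iff₀ hε] at this
    rw [div_le_iff₀ hk0]; linarith
  -- Sampling at left endpoints keeps the step function below `g ∘ U`, hence at risk at most `ψ Y`.
  let v : Fin (n * k) → ℝ := fun l => g (l / (n * k : ℕ))
  have hv : v ∈ gridSublevel ψ U (n * k) (ψ Y) := by
    rw [← hYg]
    refine hψ.mono _ _ (memLp_comp_gridIdx hU.1 v) hgU ?_
    filter_upwards [hU.ae_mem] with ω hω using hg (gridIdx_div_le hω)
  -- This average of rearrangements is constant on each coarse cell, where it is the left Riemann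
  -- sum of `g`; that is within `2M/k ≤ ε` of an upper bound for the cell mean.
  have havg : (∑ s : Fin k, (1 / k : ℝ) • (v ∘ blockShift n k s)) ∈
      gridSublevel ψ U (n * k) (ψ Y) :=
    (hψ.convex_gridSublevel hU.1 _ _).sum_mem (fun _ _ => by positivity)
      (by simp [hk0.ne']) fun s _ => hψ.comp_perm_mem_gridSublevel hU hv _
  refine absurd (hltε.trans_le ((hψ.mono _ _ ?_ (memLp_comp_gridIdx hU.1 _) ?_).trans havg))
    (lt_irrefl _)
  · exact (memLp_comp_gridIdx hU.1 _).sub (memLp_const ε)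
  filter_upwards [hU.ae_mem] with ω hω
  simp only [Finset.sum_apply, Pi.smul_apply, Function.comp_apply, smul_eq_mul]
  rw [sum_blockShift, gridIdx_mul_divNat hω]
  have h := cellMean_le_mean_add (k := k) hg hgM (gridIdx n (U ω))
  have h' : ∑ j : Fin k, (1 / k : ℝ) * v (finProdFinEquiv (gridIdx n (U ω), j)) =
      ∑ j : Fin k, (1 / k : ℝ) * g ((j + k * (gridIdx n (U ω) : ℕ)) / (n * k)) := by
    refine Finset.sum_congr rfl fun j _ => ?_
    simp only [v, finProdFinEquiv_apply_val]
    push_cast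
    rfl
  rw [h']
  linarith

end Averaging
-- Finite-dimensional separation by sorted probability vectors
section Separation

/-- A convex set missing an upper orthant is separated by a probability vector from every point
in the interior of that orthant. -/
theorem exists_probVector_separating {n : ℕ} [NeZero n] {C : Set (Fin n → ℝ)} (hC : Convex ℝ C)
    {z : Fin n → ℝ} {ε : ℝ} (hε : 0 < ε) (hz : ∀ y, (∀ i, z i - ε < y i) → y ∉ C) :
    ∃ q : Fin n → ℝ, (∀ i, 0 ≤ q i) ∧ ∑ i, q i = 1 ∧ ∀ y ∈ C, ∑ i, q i * y i < ∑ i, q i * z i := by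
  have hn : (n : ℝ) ≠ 0 := by exact_mod_cast NeZero.ne n
  rcases C.eq_empty_or_nonempty with rfl | hne
  · exact ⟨fun _ => 1 / n, fun _ => by positivity, by simp [hn], by simp⟩
  let s : Set (Fin n → ℝ) := Set.univ.pi fun i => Set.Ioi (z i - ε)
  have hs : ∀ y : Fin n → ℝ, (∀ i, z i - ε < y i) → y ∈ s := fun y hy i _ => hy i
  obtain ⟨f, u, hfs, hfC⟩ := geometric_hahn_banach_open
    (convex_pi fun i _ => convex_Ioi (z i - ε)) (isOpen_set_pi Set.finite_univ fun i _ => isOpen_Ioi)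
    hC (Set.disjoint_left.2 fun y (hy : y ∈ s) => hz y fun i => hy i trivial)
  have hfsum : ∀ y : Fin n → ℝ, f y = ∑ i, y i * f (Pi.single i 1) := by
    intro y
    conv_lhs => rw [← Finset.univ_sum_single y]
    rw [map_sum]
    refine Finset.sum_congr rfl fun i _ => ?_
    rw [← smul_eq_mul, ← map_smul, ← Pi.single_smul, smul_eq_mul, mul_one]
  have hzs : f z < u := hfs z (hs z fun i => by linarith)
  have hneg : ∀ i, f (Pi.single i 1) ≤ 0 := by
    intro i
    -- A positive coefficient would let `z`, moved upward inside the orthant, reach the value `u`.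
    refine not_lt.1 fun hpos => ?_
    have hpos' : 0 ≤ (u - f z) / f (Pi.single i 1) := div_nonneg (by linarith) hpos.le
    have h := hfs (z + ((u - f z) / f (Pi.single i 1)) • Pi.single i 1) (hs _ fun j => by
      have : (0 : ℝ) ≤ (Pi.single i 1 : Fin n → ℝ) j := by
        rw [Pi.single_apply]; split_ifs <;> norm_num
      have := mul_nonneg hpos' this
      simp only [Pi.add_apply, Pi.smul_apply, smul_eq_mul]
      linarith)
    rw [map_add, map_smul, smul_eq_mul, div_mul_cancel₀ _ hpos.ne'] at h
    linarith
  set S := ∑ i, -f (Pi.single i 1) with hS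
  have hS0 : 0 ≤ S := Finset.sum_nonneg fun i _ => neg_nonneg.2 (hneg i)
  -- If `S = 0` then `f = 0`, and `f z < u ≤ f y` for a point `y` of `C` is impossible.
  have hSpos : 0 < S := by
    refine hS0.lt_of_ne fun h => ?_
    have h0 : ∀ i, f (Pi.single i 1) = 0 := fun i => by
      have := (Finset.sum_eq_zero_iff_of_nonneg fun i _ => neg_nonneg.2 (hneg i)).1 h.symm i
        (Finset.mem_univ i)
      linarith
    obtain ⟨y, hy⟩ := hne
    have h1 := hfC y hy
    rw [hfsum] at h1 hzs
    simp only [h0, mul_zero, Finset.sum_const_zero] at h1 hzs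
    linarith
  have hq : ∀ y : Fin n → ℝ, ∑ i, -f (Pi.single i 1) / S * y i = -f y / S := by
    intro y
    rw [hfsum y, ← Finset.sum_neg_distrib, Finset.sum_div]
    exact Finset.sum_congr rfl fun i _ => by ring
  refine ⟨fun i => -f (Pi.single i 1) / S, fun i => div_nonneg (neg_nonneg.2 (hneg i)) hS0, ?_, ?_⟩
  · rw [← Finset.sum_div, ← hS, div_self hSpos.ne']
  · intro y hy
    rw [hq, hq]
    exact div_lt_div_of_pos_right (by linarith [hfC y hy]) hSpos

/-- For permutation-invariant sets and monotone points the separating vector can be sorted. -/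
theorem exists_monotone_probVector_separating {n : ℕ} [NeZero n] {C : Set (Fin n → ℝ)}
    (hC : Convex ℝ C) (hperm : ∀ y ∈ C, ∀ σ : Equiv.Perm (Fin n), y ∘ σ ∈ C)
    {z : Fin n → ℝ} (hzm : Monotone z) {ε : ℝ} (hε : 0 < ε)
    (hz : ∀ y, (∀ i, z i - ε < y i) → y ∉ C) :
    ∃ q : Fin n → ℝ, Monotone q ∧ (∀ i, 0 ≤ q i) ∧ ∑ i, q i = 1 ∧
      ∀ y ∈ C, ∑ i, q i * y i < ∑ i, q i * z i := by
  obtain ⟨q, hq0, hq1, hq⟩ := exists_probVector_separating hC hε hz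
  set σ := Tuple.sort q
  have hmono : Monotone (q ∘ σ) := Tuple.monotone_sort q
  refine ⟨q ∘ σ, hmono, fun i => hq0 _, (Equiv.sum_comp σ q).trans hq1, fun y hy => ?_⟩
  -- Sorting `q` is paid for on the left by the invariance of `C`, and on the right by the
  -- rearrangement inequality for the monotone `z`.
  calc ∑ i, (q ∘ σ) i * y i = ∑ i, q i * (y ∘ σ.symm) i := by
        rw [← Equiv.sum_comp σ fun i => q i * (y ∘ σ.symm) i]
        simp
    _ < ∑ i, q i * z i := hq _ (hperm y hy _)
    _ = ∑ i, z i * (q ∘ σ) (σ.symm i) := by simp [mul_comm]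
    _ ≤ ∑ i, z i * (q ∘ σ) i := (hzm.monovary hmono).sum_mul_comp_perm_le_sum_mul
    _ = ∑ i, (q ∘ σ) i * z i := by simp only [mul_comm]

end Separation

/-! ### Dual certificates and attainment -/

section Representation

variable {Ω : Type*} [MeasurableSpace Ω] {P : Measure Ω} [IsProbabilityMeasure P]
  {ψ : (Ω → ℝ) → ℝ≥0∞}

/-- Left-endpoint samples on the nested dyadic grids increase to the quantile function at its
continuity points, that is at almost every value of `U`, so continuity from below applies. -/
theorem IsLawInvariantRisk.exists_lt_grid (hψ : IsLawInvariantRisk P ψ) {U : Ω → ℝ}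
    (hU : IsUniform P U) {Y : Ω → ℝ} (hY : MemLp Y ∞ P) {M : ℝ} (hM : ∀ᵐ ω ∂P, |Y ω| ≤ M)
    {c : ℝ≥0∞} (hc : c < ψ Y) :
    ∃ (n : ℕ) (_ : NeZero n), c < ψ fun ω => extQuantile P M Y ((gridIdx n (U ω) : ℕ) / n) := by
  set g := extQuantile P M Y with hgdef
  have hg : Monotone g := extQuantile_mono hY.1.aemeasurable hM
  have hgM : ∀ u, |g u| ≤ M := abs_extQuantile_le hY.1.aemeasurable hM
  have hgU : MemLp (fun ω => g (U ω)) ∞ P :=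
    memLp_top_of_abs_le (hg.measurable.comp hU.1).aemeasurable (Eventually.of_forall fun ω => hgM _)
  have hYg : ψ (fun ω => g (U ω)) = ψ Y :=
    hψ.law _ _ hgU hY (hU.identDistrib_extQuantile hY.1.aemeasurable hM)
  have hcont : ∀ᵐ ω ∂P, ContinuousAt g (U ω) := by
    have h : ∀ᵐ u ∂(P.map U), u ∉ {u | ¬ContinuousAt g u} := by
      rw [hU.2]
      exact hg.countable_not_continuousAt.ae_notMem _
    filter_upwards [ae_of_ae_map hU.1.aemeasurable h] with ω hω using not_not.1 hω
  have hlim := hψ.continuous (fun m ω => g ((gridIdx (2 ^ m) (U ω) : ℕ) / (2 ^ m : ℕ))) _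
    (fun m => memLp_comp_gridIdx hU.1 fun i : Fin (2 ^ m) => g ((i : ℕ) / (2 ^ m : ℕ))) hgU ?_ ?_
  · rw [hYg] at hlim
    obtain ⟨m, hm⟩ := (hlim.eventually (lt_mem_nhds hc)).exists
    exact ⟨2 ^ m, inferInstance, hm⟩
  · intro m
    filter_upwards [hU.ae_mem] with ω hω
    refine hg ?_
    rw [← gridIdx_mul_divNat (k := 2) hω, Fin.coe_divNat,
      div_le_div_iff₀ (by positivity) (by positivity)]
    have h : (gridIdx (2 ^ m * 2) (U ω) : ℕ) / 2 * 2 ≤ (gridIdx (2 ^ (m + 1)) (U ω) : ℕ) :=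
      Nat.div_mul_le_self _ _
    have h' : (((gridIdx (2 ^ m * 2) (U ω) : ℕ) / 2 : ℕ) : ℝ) * 2 ≤
        (gridIdx (2 ^ (m + 1)) (U ω) : ℕ) := by exact_mod_cast h
    have h2 : (0 : ℝ) < 2 ^ m := by positivity
    push_cast [pow_succ]
    nlinarith
  · filter_upwards [hU.ae_mem, hcont] with ω hω hω'
    refine hω'.tendsto.comp ?_
    have h := (tendsto_nat_floor_mul_div_atTop (R := ℝ) hω.1.le).comp
      (tendsto_pow_atTop_atTop_of_one_lt (show (1 : ℝ) < 2 by norm_num))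
    refine h.congr fun m => ?_
    rw [gridIdx_val hω]
    simp [mul_comm]

omit [IsProbabilityMeasure P] in
theorem integral_grid_mul {U : Ω → ℝ} (hU : IsUniform P U) {n : ℕ} [NeZero n] (q : Fin n → ℝ)
    {g : ℝ → ℝ} (hg : Monotone g) :
    ∫ ω, (n * q (gridIdx n (U ω))) * g (U ω) ∂P = ∑ i, q i * cellMean n g i := by
  have hn : (0 : ℝ) < n := by exact_mod_cast NeZero.pos n
  have hqm : Measurable fun u => (n : ℝ) * q (gridIdx n u) :=
    ((measurable_of_countable q).comp (measurable_gridIdx n)).const_mul _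
  rw [hU.integral_comp (f := fun u => (n * q (gridIdx n u)) * g u) (hqm.mul hg.measurable)]
  have hint : ∀ a b : ℝ, IntervalIntegrable (fun u => (n * q (gridIdx n u)) * g u) volume a b := by
    intro a b
    rw [intervalIntegrable_iff]
    refine ((hg.intervalIntegrable (a := a) (b := b)).def').bdd_mul (c := n * ∑ i, |q i|)
      hqm.aestronglyMeasurable (Eventually.of_forall fun u => ?_)
    rw [Real.norm_eq_abs, abs_mul, abs_of_pos hn]
    exact mul_le_mul_of_nonneg_left (Finset.single_le_sum (f := fun i => |q i|)
      (fun _ _ => abs_nonneg _) (Finset.mem_univ _)) hn.le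
  have h := intervalIntegral.sum_integral_adjacent_intervals (n := n)
    (a := fun k : ℕ => (k / n : ℝ)) (μ := volume) fun k _ => hint _ _
  simp only [Nat.cast_zero, zero_div, div_self hn.ne'] at h
  rw [← h, ← Fin.sum_univ_eq_sum_range fun k : ℕ =>
    ∫ u in (k / n : ℝ)..((k + 1 : ℕ) / n : ℝ), (n * q (gridIdx n u)) * g u]
  refine Finset.sum_congr rfl fun i _ => ?_
  have hle : (i / n : ℝ) ≤ ((i : ℕ) + 1) / n := by gcongr; linarith
  have hi : ((i : ℕ) : ℝ) + 1 ≤ n := by exact_mod_cast i.2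
  have hcongr : ∫ u in (i / n : ℝ)..((i : ℕ) + 1) / n, (n * q (gridIdx n u)) * g u =
      ∫ u in (i / n : ℝ)..((i : ℕ) + 1) / n, (n * q i) * g u := by
    rw [intervalIntegral.integral_of_le hle, intervalIntegral.integral_of_le hle,
      integral_Ioc_eq_integral_Ioo, integral_Ioc_eq_integral_Ioo]
    refine setIntegral_congr_fun measurableSet_Ioo fun u hu => ?_
    have hu' : u ∈ Set.Ioo (0 : ℝ) 1 :=
      ⟨(by positivity : (0 : ℝ) ≤ i / n).trans_lt hu.1, hu.2.trans_le ((div_le_one hn).2 hi)⟩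
    have := (gridIdx_eq_iff hu' i).2 ⟨hu.1.le, hu.2⟩
    simp only [this]
  push_cast
  rw [hcongr, intervalIntegral.integral_const_mul, cellMean]
  ring

/-- A real-valued version of the density `dQ/dP`. -/
noncomputable def density (Q : AbsContProb P) (ω : Ω) : ℝ :=
  ((Q.1 : Measure Ω).rnDeriv P ω).toReal

omit [IsProbabilityMeasure P] in
theorem measurable_density (Q : AbsContProb P) : Measurable (density Q) :=
  (Measure.measurable_rnDeriv _ _).ennreal_toReal

omit [IsProbabilityMeasure P] in
theorem density_nonneg (Q : AbsContProb P) : 0 ≤ density Q := fun _ => ENNReal.toReal_nonneg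

omit [IsProbabilityMeasure P] in
theorem integrable_density (Q : AbsContProb P) : Integrable (density Q) P :=
  Measure.integrable_toReal_rnDeriv

theorem integral_density_mul (Q : AbsContProb P) (W : Ω → ℝ) :
    ∫ ω, density Q ω * W ω ∂P = ∫ ω, W ω ∂(Q.1 : Measure Ω) :=
  integral_toReal_rnDeriv_mul Q.2

theorem integral_density (Q : AbsContProb P) : ∫ ω, density Q ω ∂P = 1 := by
  simpa using integral_density_mul Q fun _ => 1

/-- The probability measure whose density is a grid function of `U`. -/
theorem exists_density_eq_grid {U : Ω → ℝ} (hU : IsUniform P U) {n : ℕ} [NeZero n]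
    {q : Fin n → ℝ} (hq0 : ∀ i, 0 ≤ q i) (hq1 : ∑ i, q i = 1) :
    ∃ Q : AbsContProb P, density Q =ᵐ[P] fun ω => n * q (gridIdx n (U ω)) := by
  have hn : (0 : ℝ) < n := by exact_mod_cast NeZero.pos n
  set D : Ω → ℝ := fun ω => n * q (gridIdx n (U ω)) with hD
  have hDm : Measurable D := (measurable_comp_gridIdx hU.1 q).const_mul _
  have hD0 : ∀ ω, 0 ≤ D ω := fun ω => mul_nonneg hn.le (hq0 _)
  have hDi : Integrable D P :=
    ((memLp_comp_gridIdx hU.1 q).integrable le_top).const_mul _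
  have hD1 : ∫ ω, D ω ∂P = 1 := by
    have h := integral_grid_mul hU q (g := fun _ => 1) monotone_const
    simp only [mul_one] at h
    rw [hD, h]
    refine (Finset.sum_congr rfl fun i _ => ?_).trans hq1
    rw [cellMean, intervalIntegral.integral_const, smul_eq_mul]
    field_simp
    ring
  have hprob : IsProbabilityMeasure (P.withDensity fun ω => ENNReal.ofReal (D ω)) := by
    refine ⟨?_⟩
    rw [withDensity_apply _ MeasurableSet.univ, Measure.restrict_univ,
      ← ofReal_integral_eq_lintegral_ofReal hDi (Eventually.of_forall hD0), hD1, ENNReal.ofReal_one]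
  refine ⟨⟨⟨_, hprob⟩, withDensity_absolutelyContinuous _ _⟩, ?_⟩
  filter_upwards [Measure.rnDeriv_withDensity P hDm.ennreal_ofReal] with ω hω
  change (((P.withDensity fun ω => ENNReal.ofReal (D ω))).rnDeriv P ω).toReal = D ω
  rw [hω, ENNReal.toReal_ofReal (hD0 ω)]

/-- Kusuoka's mixing measure of `Q`. -/
noncomputable def kusuokaProb (Q : AbsContProb P) : ProbabilityMeasure (Set.Ico (0 : ℝ) 1) :=
  ⟨kusuokaMeasure P (density Q), isProbabilityMeasure_kusuokaMeasure (measurable_density Q)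
    (density_nonneg Q) (integrable_density Q) (integral_density Q)⟩

theorem integral_kusuokaProb (Q : AbsContProb P) {U : Ω → ℝ} (hU : IsUniform P U)
    (hQU : IsComonotone P (density Q) U) {Y : Ω → ℝ} (hY : AEMeasurable Y P) {M : ℝ}
    (hM : ∀ᵐ ω ∂P, |Y ω| ≤ M) :
    ∫ α, avar P (α : ℝ) Y ∂(kusuokaProb Q : Measure (Set.Ico (0 : ℝ) 1)) =
      ∫ ω, density Q ω * extQuantile P M Y (U ω) ∂P :=
  integral_kusuokaMeasure (measurable_density Q) (density_nonneg Q) (integrable_density Q) hU hQU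
    hY hM

theorem integrable_avar {Y : Ω → ℝ} (hY : MemLp Y ∞ P) (μ : Measure (Set.Ico (0 : ℝ) 1))
    [IsFiniteMeasure μ] : Integrable (fun α : Set.Ico (0 : ℝ) 1 => avar P (α : ℝ) Y) μ := by
  obtain ⟨M, hM⟩ := exists_ae_abs_le hY
  exact Integrable.of_bound (measurable_avar hY.1.aemeasurable hM).aestronglyMeasurable M
    (Eventually.of_forall fun α => abs_avar_le hY.1.aemeasurable hM α.2)

/-- Some rearrangement of `Z` attains the mixture of `AV@R`s under `Q`. -/
theorem IsNonatomic.exists_identDistrib_integral_eq (hP : IsNonatomic P) (Q : AbsContProb P)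
    {Z : Ω → ℝ} (hZ : MemLp Z ∞ P) :
    ∃ W : Ω → ℝ, MemLp W ∞ P ∧ IdentDistrib W Z P P ∧
      ∫ ω, W ω ∂(Q.1 : Measure Ω) =
        ∫ α, avar P (α : ℝ) Z ∂(kusuokaProb Q : Measure (Set.Ico (0 : ℝ) 1)) := by
  obtain ⟨M, hM⟩ := exists_ae_abs_le hZ
  obtain ⟨U, hU, hQU⟩ := hP.exists_comonotone_uniform (measurable_density Q)
  have hZm := hZ.1.aemeasurable
  refine ⟨fun ω => extQuantile P M Z (U ω),
    memLp_top_of_abs_le ((extQuantile_mono hZm hM).measurable.comp hU.1).aemeasurable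
      (Eventually.of_forall fun ω => abs_extQuantile_le hZm hM _),
    hU.identDistrib_extQuantile hZm hM, ?_⟩
  rw [integral_kusuokaProb Q hU (hU.isComonotone hQU) hZm hM, integral_density_mul]

/-- Every risk level below `ψ Z` is certified by some `Q`. -/
theorem IsLawInvariantRisk.exists_dual_certificate (hψ : IsLawInvariantRisk P ψ)
    (hP : IsNonatomic P) {Z : Ω → ℝ} (hZ : MemLp Z ∞ P) {c : ℝ≥0∞} (hc : c < ψ Z) :
    ∃ Q : AbsContProb P, ∀ Y : Ω → ℝ, MemLp Y ∞ P →
      ∫ α, avar P (α : ℝ) Z ∂(kusuokaProb Q : Measure (Set.Ico (0 : ℝ) 1)) ≤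
        ∫ ω, Y ω ∂(Q.1 : Measure Ω) → c < ψ Y := by
  obtain ⟨U, hU, -⟩ := hP.exists_comonotone_uniform (P := P) (D := fun _ => 0) measurable_const
  obtain ⟨M, hM⟩ := exists_ae_abs_le hZ
  have hZm := hZ.1.aemeasurable
  have hg := extQuantile_mono hZm hM
  obtain ⟨n, _, hn⟩ := hψ.exists_lt_grid hU hZ hM hc
  have hn0 : (0 : ℝ) < n := by exact_mod_cast NeZero.pos n
  let z : Fin n → ℝ := fun i => extQuantile P M Z ((i : ℕ) / n)
  have hzm : Monotone z := fun i j hij => hg (by gcongr; exact hij)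
  obtain ⟨ε, hε, hcε⟩ := hψ.exists_lt_sub (memLp_comp_gridIdx hU.1 z) hn
  -- A point of the orthant `y > z - ε` has risk at least `ψ (z - ε) > c` by monotonicity, so the
  -- orthant misses the sublevel set.
  obtain ⟨q, hqm, hq0, hq1, hq⟩ := exists_monotone_probVector_separating
    (hψ.convex_gridSublevel hU.1 n c)
    (fun y hy σ => hψ.comp_perm_mem_gridSublevel hU hy σ) hzm hε fun y hy hyC => by
      refine absurd (hcε.trans_le ((hψ.mono _ _ ?_ (memLp_comp_gridIdx hU.1 y) ?_).trans hyC))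
        (lt_irrefl _)
      · exact (memLp_comp_gridIdx hU.1 z).sub (memLp_const ε)
      · exact Eventually.of_forall fun ω => (hy _).le
  obtain ⟨Q, hQ⟩ := exists_density_eq_grid hU hq0 hq1
  -- Because `q` is sorted, the density is a nondecreasing function of the very `U` that defines the
  -- grid.
  have hQU : IsComonotone P (density Q) U :=
    (hU.isComonotone fun ω ω' h => mul_le_mul_of_nonneg_left
      (hqm (gridIdx_mono n h.le)) hn0.le).congr hQ.symm
  have hval : ∀ {Y : Ω → ℝ} {K : ℝ}, AEMeasurable Y P → (∀ᵐ ω ∂P, |Y ω| ≤ K) →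
      ∫ ω, density Q ω * extQuantile P K Y (U ω) ∂P =
        ∑ i, q i * cellMean n (extQuantile P K Y) i := by
    intro Y K hY hK
    rw [← integral_grid_mul hU q (extQuantile_mono hY hK)]
    refine integral_congr_ae ?_
    filter_upwards [hQ] with ω hω
    rw [hω]
  refine ⟨Q, fun Y hY hle => not_le.1 fun hYc => ?_⟩
  obtain ⟨K, hK⟩ := exists_ae_abs_le hY
  have hYm := hY.1.aemeasurable
  -- If `ψ Y ≤ c`, then `E_Q[Y] ≤ ∑ q_i mean_i(q_Y) < ∑ q_i z_i ≤ ∑ q_i mean_i(q_Z)`, and the last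
  -- sum is the mixture of `AV@R`s of `Z`, against the constraint.
  have h1 : ∫ ω, Y ω ∂(Q.1 : Measure Ω) ≤ ∑ i, q i * cellMean n (extQuantile P K Y) i := by
    rw [← integral_density_mul, ← hval hYm hK]
    exact integral_mul_le_integral_mul_extQuantile (measurable_density Q) (density_nonneg Q)
      (integrable_density Q) hU hQU hYm hK
  have h2 := hq _ ((hψ.cellMean_extQuantile_le hU hY hK n).trans hYc)
  have h3 : ∑ i, q i * z i ≤ ∑ i, q i * cellMean n (extQuantile P M Z) i :=
    Finset.sum_le_sum fun i _ => mul_le_mul_of_nonneg_left (cellMean_ge hg i) (hq0 i)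
  rw [integral_kusuokaProb Q hU hQU hZm hM, hval hZm hM] at hle
  linarith

end Representation
end GeoRisk

theorem mainTheorem6 {Ω : Type*} [MeasurableSpace Ω] (P : Measure Ω) [IsProbabilityMeasure P]
    (hP : GeoRisk.IsNonatomic P) :
    ∃ m : GeoRisk.AbsContProb P → ProbabilityMeasure (Set.Ico (0 : ℝ) 1),
      ∀ ρ : (Ω → ℝ) → ℝ≥0∞,
        GeoRisk.IsMonotone P ρ → GeoRisk.IsQuasiLogconvex P ρ →
        GeoRisk.IsContinuousFromBelow P ρ → GeoRisk.IsLawInvariant P ρ →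
        ∀ X : Ω → ℝ, GeoRisk.MemLinfPP P X →
          (∀ Q : GeoRisk.AbsContProb P,
            Integrable (fun α : Set.Ico (0 : ℝ) 1 => Real.log (GeoRisk.arar P (α : ℝ) X))
              (m Q : Measure (Set.Ico (0 : ℝ) 1))) ∧
          ρ X = ⨆ Q : GeoRisk.AbsContProb P,
            GeoRisk.dualR P ρ
              (∫ α : Set.Ico (0 : ℝ) 1, Real.log (GeoRisk.arar P (α : ℝ) X)
                ∂(m Q : Measure (Set.Ico (0 : ℝ) 1))) Q := by
  refine ⟨GeoRisk.kusuokaProb, fun ρ h1 h2 h3 h4 X hX => ?_⟩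
  have hψ := GeoRisk.isLawInvariantRisk_exp h1 h2 h3 h4
  have hZ := hX.memLp_log
  simp only [GeoRisk.arar, Real.log_exp]
  refine ⟨fun Q => GeoRisk.integrable_avar hZ _, le_antisymm ?_ (iSup_le fun Q => ?_)⟩
  · refine le_of_forall_lt_imp_le_of_dense fun c hc => ?_
    rw [← h1.exp_log_eq hX] at hc
    obtain ⟨Q, hQ⟩ := hψ.exists_dual_certificate hP hZ hc
    refine le_iSup_of_le Q (le_sInf ?_)
    rintro _ ⟨Y, ⟨hY, hle⟩, rfl⟩
    rw [← h1.exp_log_eq hY]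
    exact (hQ _ hY.memLp_log hle).le
  -- The exponential of the rearrangement is feasible for `𝓡` and has the risk of `X`.
  · obtain ⟨W, hW, hWZ, hWQ⟩ := hP.exists_identDistrib_integral_eq Q hZ
    rw [← h1.exp_log_eq hX, ← hψ.law _ _ hW hZ hWZ]
    refine sInf_le (Set.mem_image_of_mem ρ ⟨GeoRisk.memLinfPP_exp hW, ?_⟩)
    simp only [Real.log_exp]
    exact hWQ.ge
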